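/- **Setting.** Let $\Omega\subset\mathbb R^d$, $d\ge1$, be a bounded domain (open, connected, non-empty), $X=(0,1)\times\overline\Omega$, and let $\mathcal M=\mathcal M(X)\times\mathcal M(X;\mathbb R^d)$ be the space of pairs $\mu=(\rho,m)$ of a bounded signed Borel measure and a bounded $\mathbb R^d$-valued Borel measure. For $\alpha,\beta>0$ put $$J_{\alpha,\beta}(\mu)=\beta\int_X\Psi\Big(\frac{d\rho}{d\lambda},\frac{dm}{d\lambda}\Big)d\lambda+\alpha\|\rho\|_{\mathcal M(X)}$$ if $\int_X\partial_t\psi\,d\rho+\int_X\nabla\psi\cdot dm=0$ for all $\psi\in C_c^\infty(X)$ (restrictions to $X$ of functions in $C^\infty_c((0,1)\times\mathbb R^d)$), and $J_{\alpha,\beta}(\mu)=+\infty$ otherwise. Here $\lambda\ge0$ is any finite measure with $\rho,m\ll\lambda$, and $\Psi(s,x)=|x|^2/(2s)$ for $s>0$, $\Psi(0,0)=0$, $\Psi=+\infty$ otherwise. Let $C_{\alpha,\beta}=\{\mu\in\mathcal M: J_{\alpha,\beta}(\mu)\le1\}$, with set of extremal points $\mathrm{ext}(C_{\alpha,\beta})$.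 A curve $t\in[0,1]\mapsto\rho_t\in\mathcal M(\overline\Omega)$ is in $C_{\rm w}$ if $t\mapsto\int k\,d\rho_t$ is continuous for every $k\in C(\overline\Omega)$; $\rho=dt\otimes\rho_t$ means that $t\mapsto\rho_t$ is a Borel family and $\int_X\psi\,d\rho=\int_0^1\int_{\overline\Omega}\psi(t,x)\,d\rho_t(x)\,dt$ for all $\rho$-integrable $\psi$. Let $(H_t)_{t\in[0,1]}$ be real Hilbert spaces, $D$ a real Banach space, and $i_t:D\to H_t$ bounded linear maps such that $\|i_t\|\le C$ and $i_t(D)$ is dense in $H_t$ for a.e. $t$, and $t\mapsto\langle i_t\eta,i_t\psi\rangle_{H_t}$ is Lebesgue measurable for all $\eta,\psi\in D$. A map $t\mapsto g_t\in H_t$ is strongly measurable if there are $D$-valued step functions $s^n$ with $i_ts^n_t\to g_t$ in $H_t$ for a.e. $t$; $L^2_H$ is the space of strongly measurable $g$ with $\int_0^1\|g_t\|^2_{H_t}dt<\infty$. Let $K_t^*:\mathcal M(\overline\Omega)\to H_t$ be linear and, for a.e. $t$, weak*-to-weak continuous, with pre-adjoint $K_t:H_t\to C(\overline\Omega)$,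 and with $\|K_t^*\|\le C$; assume that $t\mapsto K_t^*\rho$ is strongly measurable for every $\rho\in\mathcal M(\overline\Omega)$. Fix $f\in L^2_H$ and $(t\mapsto\tilde\rho_t)\in C_{\rm w}$, and set $w_t=-K_t(K_t^*\tilde\rho_t-f_t)\in C(\overline\Omega)$. For $\rho\in\mathcal M(X)$ let $\langle\rho,w\rangle=\int_0^1\int_{\overline\Omega}w_t\,d\rho_t\,dt$ if $\rho=dt\otimes\rho_t$ with $(t\mapsto\rho_t)\in C_{\rm w}$, and $\langle\rho,w\rangle=-\infty$ otherwise. Let $M_0=T_{\alpha,\beta}(0)$, where $$T_{\alpha,\beta}(\mu)=\tfrac12\int_0^1\|K_t^*\rho_t-f_t\|^2_{H_t}dt+J_{\alpha,\beta}(\mu)$$ if $\rho=dt\otimes\rho_t$ with $(t\mapsto\rho_t)\in C_{\rm w}$, and $T_{\alpha,\beta}(\mu)=+\infty$ otherwise; that is, $M_0=\frac12\int_0^1\|f_t\|^2_{H_t}dt$. Let $\varphi(s)=s$ for $0\le s\le M_0$, $\varphi(s)=\frac{s^2+M_0^2}{2M_0}$ for $s>M_0$ (read as $+\infty$ if $M_0=0$),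 and $\varphi(+\infty)=+\infty$. **Proposition.** The problem $$\min_{\mu\in C_{\alpha,\beta}}-\langle\rho,w\rangle\qquad(1)$$ admits a solution $\mu^*=(\rho^*,m^*)\in\mathrm{ext}(C_{\alpha,\beta})$. Moreover, for every solution $\mu^*\in\mathrm{ext}(C_{\alpha,\beta})$ of (1), $M\mu^*$ is a minimiser of $$\min_{\mu\in\mathcal M}-\langle\rho,w\rangle+\varphi(J_{\alpha,\beta}(\mu)),$$ where $M=0$ if $\langle\rho^*,w\rangle\le1$ and $M=M_0\langle\rho^*,w\rangle$ if $\langle\rho^*,w\rangle>1$. -/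

import Mathlib

open MeasureTheory Set Filter Topology
open scoped ENNReal NNReal unitInterval ContDiff

noncomputable section

namespace DynOT

/-! ### Measures, narrow continuity, disintegration -/

/-- The time-space cylinder `X = (0,1) × closure Ω`. -/
abbrev Cyl {d : ℕ} (Ω : Set (EuclideanSpace ℝ (Fin d))) : Type :=
  Ioo (0 : ℝ) 1 × closure Ω

/-- The space of pairs `μ = (ρ, m)` of a finite signed Borel measure and a finite `ℝᵈ`-valued Borel
measure on the cylinder. -/
abbrev MeasPair {d : ℕ} (Ω : Set (EuclideanSpace ℝ (Fin d))) : Type :=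
  SignedMeasure (Cyl Ω) × VectorMeasure (Cyl Ω) (EuclideanSpace ℝ (Fin d))

/-- Narrowly continuous curves `t ∈ [0,1] ↦ ρ_t` of finite signed measures. -/
def NarrowlyContinuous {S : Type*} [TopologicalSpace S] [MeasurableSpace S]
    (r : I → SignedMeasure S) : Prop :=
  ∀ k : C(S, ℝ), Continuous fun t : I => ∫ᵛ x, k x ∂•(r t)

/-- `ρ = dt ⊗ r_t`: the family `r` is Borel, and integration against `ρ` is iterated integration,
for every integrable `φ`. -/
def Disintegrates {d : ℕ} {Ω : Set (EuclideanSpace ℝ (Fin d))}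
    (ρ : SignedMeasure (Cyl Ω)) (r : I → SignedMeasure (closure Ω)) : Prop :=
  (∀ A : Set (closure Ω), MeasurableSet A → Measurable fun t : I => r t A) ∧
  ∀ φ : Cyl Ω → ℝ, Integrable φ ρ.totalVariation →
    ∫ᵛ z, φ z ∂•ρ =
      ∫ t : Ioo (0 : ℝ) 1, ∫ᵛ x, φ (t, x) ∂•(r (Set.inclusion Ioo_subset_Icc_self t))
        ∂(Measure.comap Subtype.val volume)

/-! ### The regularizer -/

/-- The continuity equation `∂ₜρ + div m = 0` in the sense of distributions on `X`. Test functions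
are the restrictions to `X` of smooth functions with compact support in `(0,1) × ℝᵈ`; they need not
vanish on the lateral boundary `(0,1) × ∂Ω`. -/
def ContinuityEquation {d : ℕ} {Ω : Set (EuclideanSpace ℝ (Fin d))} (μ : MeasPair Ω) : Prop :=
  ∀ φ : ℝ × EuclideanSpace ℝ (Fin d) → ℝ, ContDiff ℝ ∞ φ → HasCompactSupport φ →
    tsupport φ ⊆ Ioo (0 : ℝ) 1 ×ˢ univ →
    (∫ᵛ z, deriv (fun s : ℝ => φ (s, (z.2 : EuclideanSpace ℝ (Fin d)))) (z.1 : ℝ) ∂•μ.1) +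
      (∫ᵛ z, gradient (fun y : EuclideanSpace ℝ (Fin d) => φ ((z.1 : ℝ), y))
        (z.2 : EuclideanSpace ℝ (Fin d)) ∂[innerSL ℝ; μ.2]) = 0

/-- The integrand `Ψ(t, x)` of the Benamou-Brenier energy. -/
def Psi {d : ℕ} (t : ℝ) (x : EuclideanSpace ℝ (Fin d)) : ℝ≥0∞ :=
  open Classical in
  if 0 < t then ENNReal.ofReal (‖x‖ ^ 2 / (2 * t)) else if t = 0 ∧ x = 0 then 0 else ⊤

/-- The `i`-th coordinate of an `ℝᵈ`-valued measure. -/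
def coordMeasure {d : ℕ} {Z : Type*} [MeasurableSpace Z]
    (m : VectorMeasure Z (EuclideanSpace ℝ (Fin d))) (i : Fin d) : SignedMeasure Z :=
  m.mapRange (EuclideanSpace.proj i : EuclideanSpace ℝ (Fin d) →L[ℝ] ℝ).toLinearMap.toAddMonoidHom
    (EuclideanSpace.proj i : EuclideanSpace ℝ (Fin d) →L[ℝ] ℝ).continuous

theorem coordMeasure_apply {d : ℕ} {Z : Type*} [MeasurableSpace Z]
    (m : VectorMeasure Z (EuclideanSpace ℝ (Fin d))) (i : Fin d) (A : Set Z) :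
    coordMeasure m i A = m A i :=
  rfl

/-- The positive finite measure `|ρ| + ∑ᵢ |mᵢ|`, with respect to which `ρ` and `m` are absolutely
continuous. -/
def refMeasure {d : ℕ} {Ω : Set (EuclideanSpace ℝ (Fin d))} (μ : MeasPair Ω) : Measure (Cyl Ω) :=
  μ.1.totalVariation + ∑ i, (coordMeasure μ.2 i).totalVariation

/-- The Benamou-Brenier energy `∫ Ψ(dρ/dλ, dm/dλ) dλ`, computed with the dominating measure
`λ = |ρ| + ∑ᵢ |mᵢ|` (as `Ψ` is one-homogeneous, the choice of `λ` does not matter). -/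
def benamouBrenier {d : ℕ} {Ω : Set (EuclideanSpace ℝ (Fin d))} (μ : MeasPair Ω) : ℝ≥0∞ :=
  ∫⁻ z, Psi (μ.1.rnDeriv (refMeasure μ) z)
    (WithLp.toLp 2 fun i => (coordMeasure μ.2 i).rnDeriv (refMeasure μ) z) ∂(refMeasure μ)

/-- The regularizer `J_{α,β}`. -/
def J {d : ℕ} {Ω : Set (EuclideanSpace ℝ (Fin d))} (α β : ℝ) (μ : MeasPair Ω) : ℝ≥0∞ :=
  open Classical in
  if ContinuityEquation μ then
    ENNReal.ofReal β * benamouBrenier μ + ENNReal.ofReal α * μ.1.totalVariation univ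
  else ⊤

/-- The unit ball `C_{α,β} = {J_{α,β} ≤ 1}`. -/
def unitBall {d : ℕ} (Ω : Set (EuclideanSpace ℝ (Fin d))) (α β : ℝ) : Set (MeasPair Ω) :=
  {μ | J α β μ ≤ 1}

/-! ### Time-dependent Hilbert spaces -/

section Hilbert

variable {D : Type*} [NormedAddCommGroup D] [NormedSpace ℝ D]
  {H : I → Type*} [∀ t, NormedAddCommGroup (H t)] [∀ t, InnerProductSpace ℝ (H t)]

/-- Assumptions on the embeddings `i_t : D → H_t`: uniformly bounded, with dense range, and with
Lebesgue measurable `t ↦ ⟪i_t φ, i_t ψ⟫`. An a.e.-measurable real function on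
`[0,1]` is the same as a Lebesgue measurable one. -/
structure AssumptionH (i : ∀ t, D →L[ℝ] H t) : Prop where
  bound : ∃ C : ℝ, 0 < C ∧ ∀ᵐ t : I, ‖i t‖ ≤ C
  dense : ∀ᵐ t : I, DenseRange (i t)
  meas : ∀ φ ψ : D, AEMeasurable (fun t : I => inner ℝ (i t φ) (i t ψ)) volume

/-- Strong measurability of `t ↦ f_t ∈ H_t`: for a.e. `t`, `f_t` is the limit of the images under
`i_t` of a sequence of `D`-valued step functions. -/
def StronglyMeasurableH (i : ∀ t, D →L[ℝ] H t) (f : ∀ t, H t) : Prop :=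
  ∃ s : ℕ → SimpleFunc I D, ∀ᵐ t : I, Tendsto (fun n => i t (s n t)) atTop (𝓝 (f t))

/-- `f ∈ L²([0,1]; H)`. -/
def MemL2H (i : ∀ t, D →L[ℝ] H t) (f : ∀ t, H t) : Prop :=
  StronglyMeasurableH i f ∧ ∫⁻ t : I, ‖f t‖ₑ ^ 2 < ⊤

end Hilbert

/-! ### Forward operators -/

section Operators

variable {S : Type*} [TopologicalSpace S] [MeasurableSpace S]
  {V : Type*} [NormedAddCommGroup V] [InnerProductSpace ℝ V]

/-- The weak* topology on finite signed measures on a compact space: the coarsest topology for which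
`ρ ↦ ∫ k dρ` is continuous, for every continuous `k`. -/
abbrev weakStar (S : Type*) [TopologicalSpace S] [MeasurableSpace S] :
    TopologicalSpace (SignedMeasure S) :=
  TopologicalSpace.induced (fun ρ (k : C(S, ℝ)) => ∫ᵛ x, k x ∂•ρ) inferInstance

/-- Weak*-to-weak continuity. -/
def WeakStarToWeakContinuous (T : SignedMeasure S →ₗ[ℝ] V) : Prop :=
  Continuous[weakStar S, inferInstance] fun ρ => toWeakSpace ℝ V (T ρ)

/-- The pre-adjoint `V → C(S)` of `T`: its value at `h` is the continuous function `k` with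
`⟪T ρ, h⟫ = ∫ k dρ` for every `ρ`, which exists if `T` is weak*-to-weak continuous and is always
unique (and `0` by convention if there is none). -/
def preadjoint (T : SignedMeasure S →ₗ[ℝ] V) (h : V) : C(S, ℝ) :=
  open Classical in
  if hk : ∃ k : C(S, ℝ), ∀ ρ : SignedMeasure S, inner ℝ (T ρ) h = ∫ᵛ x, k x ∂•ρ
  then hk.choose else 0

variable {D : Type*} [NormedAddCommGroup D] [NormedSpace ℝ D]
  {H : I → Type*} [∀ t, NormedAddCommGroup (H t)] [∀ t, InnerProductSpace ℝ (H t)]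

/-- Assumptions on the forward operators `K_t^*`, written `K t` here: weak*-to-weak continuous,
uniformly bounded, and with `t ↦ K_t^* ρ` strongly measurable. -/
structure AssumptionK (i : ∀ t, D →L[ℝ] H t) (K : ∀ t, SignedMeasure S →ₗ[ℝ] H t) : Prop where
  weak : ∀ᵐ t : I, WeakStarToWeakContinuous (K t)
  bound : ∃ C : ℝ, 0 < C ∧ ∀ᵐ t : I, ∀ ρ : SignedMeasure S,
    ‖K t ρ‖ ≤ C * (ρ.totalVariation univ).toReal
  meas : ∀ ρ : SignedMeasure S, StronglyMeasurableH i fun t => K t ρ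

/-- The dual variable `w_t = -K_t (K_t^* ρ̃_t - f_t) ∈ C(S)`. -/
def dualVariable (K : ∀ t, SignedMeasure S →ₗ[ℝ] H t) (f : ∀ t, H t) (r : I → SignedMeasure S)
    (t : I) : C(S, ℝ) :=
  -preadjoint (K t) (K t (r t) - f t)

end Operators

/-! ### The functionals -/

section Functionals

variable {d : ℕ} {Ω : Set (EuclideanSpace ℝ (Fin d))}
  {H : I → Type*} [∀ t, NormedAddCommGroup (H t)] [∀ t, InnerProductSpace ℝ (H t)]

/-- The fidelity term: `½ ∫ ‖K_t^* ρ_t - f_t‖² dt` if `ρ = dt ⊗ ρ_t` with a (necessarily unique)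
narrowly continuous curve `t ↦ ρ_t`, and `∞` otherwise. -/
def fidelity (K : ∀ t, SignedMeasure (closure Ω) →ₗ[ℝ] H t) (f : ∀ t, H t)
    (μ : MeasPair Ω) : ℝ≥0∞ :=
  open Classical in
  if h : ∃ r : I → SignedMeasure (closure Ω), NarrowlyContinuous r ∧ Disintegrates μ.1 r then
    2⁻¹ * ∫⁻ t : I, ‖K t (h.choose t) - f t‖ₑ ^ 2
  else ⊤

/-- The Tikhonov functional `T_{α,β}`. -/
def tikhonov (α β : ℝ) (K : ∀ t, SignedMeasure (closure Ω) →ₗ[ℝ] H t) (f : ∀ t, H t)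
    (μ : MeasPair Ω) : ℝ≥0∞ :=
  fidelity K f μ + J α β μ

/-- `M₀ = T_{α,β}(0)`. -/
def Mzero (α β : ℝ) (K : ∀ t, SignedMeasure (closure Ω) →ₗ[ℝ] H t) (f : ∀ t, H t) : ℝ≥0∞ :=
  tikhonov α β K f (0 : MeasPair Ω)

/-- The map `φ`, extended by `φ(∞) = ∞`. If `M₀ = 0` (that is, `f = 0`), the value for `t > 0` is
`t² / 0 = ∞`. -/
def phi (M0 t : ℝ≥0∞) : ℝ≥0∞ :=
  if t ≤ M0 then t else (t ^ 2 + M0 ^ 2) / (2 * M0)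

/-- The product `⟨ρ, w⟩ = ∫ ⟨ρ_t, w_t⟩ dt` if `ρ = dt ⊗ ρ_t` with a (necessarily unique) narrowly
continuous curve `t ↦ ρ_t`, and `-∞` otherwise. -/
def pairing (ρ : SignedMeasure (Cyl Ω)) (w : I → C(closure Ω, ℝ)) : EReal :=
  open Classical in
  if h : ∃ r : I → SignedMeasure (closure Ω), NarrowlyContinuous r ∧ Disintegrates ρ r then
    ((∫ t : I, ∫ᵛ x, w t x ∂•(h.choose t) : ℝ) : EReal)
  else ⊥

/-- The linearized surrogate functional `-⟨ρ, w⟩ + φ(J_{α,β}(μ))`. -/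
def linearized (α β : ℝ) (M0 : ℝ≥0∞) (w : I → C(closure Ω, ℝ)) (μ : MeasPair Ω) : EReal :=
  -pairing μ.1 w + ((phi M0 (J α β μ) : ℝ≥0∞) : EReal)

/-- The rescaling factor: `0` if `⟨ρ, w⟩ ≤ 1` and `M₀ ⟨ρ, w⟩` if `⟨ρ, w⟩ > 1`. -/
def rescale (M0 : ℝ≥0∞) (p : EReal) : ℝ :=
  open Classical in
  if p ≤ 1 then 0 else M0.toReal * p.toReal

end Functionals

end DynOT

end

/-!
# Extreme points of the dynamic transport ball and the linearized problem

A pair `(ρ, m)` with `J < ∞` is of the form `(ρ, v ρ)` with `ρ` positive and `v ∈ L²(ρ)`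
(`exists_flowPair_of_J_lt_top`), and then `J = β ∫ ‖v‖² / 2 dρ + α ρ(X)`. The argument rests on
three facts about such pairs.

*The pairing is an honest integral.* Testing the continuity equation with `η(t) k(x)` shows that
`t ↦ ∫ k dρ_t` has an integrable distributional derivative, so that it is, for smooth `k`, a
continuous function; taking `k = 1` shows that the time marginal of `ρ` is a multiple of the
Lebesgue measure. By density the same holds for continuous `k`, and the Riesz-Markov-Kakutani
theorem applied for each `t` gives a narrowly continuous curve representing `ρ`
(`ContinuityEquation.exists_curve`). On the other side, `w` is Bochner integrable as a map into
`C(closure Ω)` (`integrable_dualVariable`). Hence `⟨ρ, w⟩ = ∫ w dρ` whenever `J < ∞`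
(`pairing_flowPair`), and only values at pairs with `J < ∞` matter.

*The unit ball is compact.* Let pairs of measures act on pairs of continuous functions `(g, h)` on
the compact cylinder `[0,1] × closure Ω`. This action is injective on the unit ball. Its image is
cut out by closed conditions (`IsFlowFunctional`): linearity, the inequality `l (g, h) ≤ 1` whenever
`g + ‖h‖² / (2 β) ≤ α`, the continuity equation, and a time marginal proportional to the Lebesgue
measure. The last condition prevents mass from escaping to `t = 0` and `t = 1`. Conversely, a
functional with these properties is positive in `g`, hence a measure, and quadratically bounded in
`h`, hence represented by an `L²` field. As these functionals are pointwise bounded, they form a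
compact set (`isCompact_isFlowFunctional`, `image_dualPair_unitBall`).

*The pairing is continuous on the ball.* The elements of the ball have mass at most `1 / α`, so that
approximating `w` in `L¹(0, 1; C(closure Ω))` by continuous maps approximates the pairing uniformly
on the ball (`exists_extremePoint_unitBall`). A continuous affine function on a compact set attains
its maximum at an extreme point, by the Krein-Milman theorem applied to the face of maximizers
(`exists_extremePoint_forall_le`).

For the second part, let `p ≥ 0` be the maximum of the pairing over the ball. Since `J` is
positively homogeneous, `⟨ν, w⟩ ≤ p J(ν)` if `J(ν) < ∞` (`integral_cylFun_le_mul`). The linearized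
functional is thus at least `-s p + φ(s)` with `s = J(ν)`. As `φ(s) ≥ s`, this is nonnegative if
`p ≤ 1`, so that `0` is a minimizer. If `p > 1`, it is minimal at `s = M₀ p`, and the bound is
attained at the corresponding multiple of the maximizer (`linearized_rescale_le`). If `M₀ = 0`, the
penalty is infinite unless `J = 0`, and again `0` is a minimizer.
-/

namespace DynOT

/-! ### Integrals against measures with a density -/

section VectorIntegral

variable {X : Type*} [MeasurableSpace X]

theorem integral_smul_toSignedMeasure (ρ : Measure X) [IsFiniteMeasure ρ] (φ : X → ℝ) :
    ∫ᵛ x, φ x ∂•ρ.toSignedMeasure = ∫ x, φ x ∂ρ := by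
  rw [← VectorMeasure.integral_toSignedMeasure]
  congr 1
  ext
  simp

variable {E F G : Type*} [NormedAddCommGroup E] [NormedSpace ℝ E]
  [NormedAddCommGroup F] [NormedSpace ℝ F] [CompleteSpace F]
  [NormedAddCommGroup G] [NormedSpace ℝ G] [CompleteSpace G]

theorem isFiniteMeasure_variation_withDensityᵥ {ρ : Measure X} {v : X → F} (hv : Integrable v ρ) :
    IsFiniteMeasure (ρ.withDensityᵥ v).variation := by
  rw [Measure.variation_withDensityᵥ hv]
  exact ⟨by simpa [HasFiniteIntegral] using hv.2⟩

omit [CompleteSpace F] [CompleteSpace G] in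
theorem integrable_bilin_of_bounded {ρ : Measure X} {v : X → F} (hv : Integrable v ρ)
    (B : E →L[ℝ] F →L[ℝ] G) {f : X → E} (hf : StronglyMeasurable f) {C : ℝ}
    (hC : ∀ x, ‖f x‖ ≤ C) : Integrable (fun x => B (f x) (v x)) ρ := by
  refine Integrable.mono' (hv.norm.const_mul (‖B‖ * C)) ?_ (ae_of_all _ fun x => ?_)
  · exact B.aestronglyMeasurable_comp₂ hf.aestronglyMeasurable hv.aestronglyMeasurable
  · calc ‖B (f x) (v x)‖ ≤ ‖B‖ * ‖f x‖ * ‖v x‖ := B.le_opNorm₂ _ _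
      _ ≤ ‖B‖ * C * ‖v x‖ := by gcongr; exact hC x

/-- Integrating a bounded function against the vector measure with density `v` is integrating its
pairing with `v`. -/
theorem integral_withDensityᵥ_vectorMeasure {ρ : Measure X} {v : X → F} (hv : Integrable v ρ)
    (B : E →L[ℝ] F →L[ℝ] G) {f : X → E} (hf : StronglyMeasurable f) {C : ℝ}
    (hC : ∀ x, ‖f x‖ ≤ C) :
    ∫ᵛ x, f x ∂[B; ρ.withDensityᵥ v] = ∫ x, B (f x) (v x) ∂ρ := by
  have := isFiniteMeasure_variation_withDensityᵥ hv
  have key : ∀ g : SimpleFunc X E,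
      ∫ᵛ x, g x ∂[B; ρ.withDensityᵥ v] = ∫ x, B (g x) (v x) ∂ρ := by
    intro g
    have hbd : ∀ g : SimpleFunc X E, Integrable (fun x => B (g x) (v x)) ρ := fun g => by
      obtain ⟨D, hD⟩ := g.exists_forall_norm_le
      exact integrable_bilin_of_bounded hv B g.stronglyMeasurable hD
    induction g using SimpleFunc.induction with
    | const c hs =>
      rename_i s
      simp only [SimpleFunc.coe_piecewise, SimpleFunc.coe_const, Function.const_zero,
        Set.piecewise_eq_indicator]
      have h1 : ∀ x, B (s.indicator (Function.const X c) x) (v x) =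
          s.indicator (fun x => B c (v x)) x := fun x => by
        by_cases hx : x ∈ s <;> simp [hx]
      simp only [h1]
      have h2 : ∫ᵛ x, s.indicator (Function.const X c) x ∂[B; ρ.withDensityᵥ v] =
          B c (ρ.withDensityᵥ v s) := VectorMeasure.integral_indicator_const c hs
      rw [integral_indicator hs, h2, withDensityᵥ_apply hv hs]
      exact ((B c).integral_comp_comm hv.integrableOn).symm
    | add hd h1 h2 =>
      rename_i g1 g2
      simp only [SimpleFunc.coe_add, Pi.add_apply, map_add, _root_.add_apply]
      rw [VectorMeasure.integral_fun_add (SimpleFunc.integrable_of_isFiniteMeasure _)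
        (SimpleFunc.integrable_of_isFiniteMeasure _), h1, h2, integral_add (hbd _) (hbd _)]
  have hC0 : 0 ≤ |C| := abs_nonneg C
  have hC' : ∀ x, ‖f x‖ ≤ |C| := fun x => (hC x).trans (le_abs_self C)
  -- both sides are continuous under bounded convergence, so simple functions suffice
  refine tendsto_nhds_unique (f := fun n => ∫ᵛ x, hf.approxBounded |C| n x ∂[B; ρ.withDensityᵥ v])
    (l := atTop) ?_ ?_
  · refine VectorMeasure.tendsto_integral_of_dominated_convergence (fun _ => |C|)
      (fun n => (SimpleFunc.stronglyMeasurable _).aestronglyMeasurable) (integrable_const _)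
      (fun n => ae_of_all _ fun x => hf.norm_approxBounded_le hC0 n x)
      (ae_of_all _ fun x => hf.tendsto_approxBounded_of_norm_le (hC' x))
  · simp only [key]
    refine tendsto_integral_of_dominated_convergence (fun x => ‖B‖ * |C| * ‖v x‖)
      (fun n => B.aestronglyMeasurable_comp₂ (SimpleFunc.stronglyMeasurable _).aestronglyMeasurable
        hv.aestronglyMeasurable) (hv.norm.const_mul _) (fun n => ae_of_all _ fun x => ?_)
      (ae_of_all _ fun x => ?_)
    · calc _ ≤ ‖B‖ * ‖hf.approxBounded |C| n x‖ * ‖v x‖ := B.le_opNorm₂ _ _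
        _ ≤ ‖B‖ * |C| * ‖v x‖ := by gcongr; exact hf.norm_approxBounded_le hC0 n x
    · have := hf.tendsto_approxBounded_of_norm_le (hC' x)
      exact ((B.flip (v x)).continuous.tendsto _).comp this

end VectorIntegral

/-! ### The Benamou-Brenier energy in terms of a density and a velocity -/

section Energy

variable {d : ℕ} {Ω : Set (EuclideanSpace ℝ (Fin d))}

/-- The pair `(ρ, v ρ)` of a positive measure and its momentum for the velocity field `v`. -/
noncomputable def flowPair (ρ : Measure (Cyl Ω)) [IsFiniteMeasure ρ]
    (v : Cyl Ω → EuclideanSpace ℝ (Fin d)) : MeasPair Ω :=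
  (ρ.toSignedMeasure, ρ.withDensityᵥ v)

theorem totalVariation_toSignedMeasure {Z : Type*} [MeasurableSpace Z] (ρ : Measure Z)
    [IsFiniteMeasure ρ] : ρ.toSignedMeasure.totalVariation = ρ := by
  rw [SignedMeasure.totalVariation_eq_variation, Measure.variation_toSignedMeasure]

instance (μ : MeasPair Ω) : IsFiniteMeasure (refMeasure μ) := by
  unfold refMeasure
  infer_instance

theorem measurable_Psi : Measurable fun p : ℝ × EuclideanSpace ℝ (Fin d) => Psi p.1 p.2 := by
  classical
  unfold Psi
  refine Measurable.ite (measurableSet_lt measurable_const measurable_fst) (by fun_prop)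
    (Measurable.ite ?_ measurable_const measurable_const)
  exact (measurable_fst (measurableSet_singleton _)).inter
    (measurable_snd (measurableSet_singleton _))

theorem absolutelyContinuous_of_totalVariation_le {Z : Type*} [MeasurableSpace Z]
    {s : SignedMeasure Z} {lam : Measure Z} (h : s.totalVariation ≤ lam) :
    s ≪ᵥ lam.toENNRealVectorMeasure := by
  rw [SignedMeasure.absolutelyContinuous_ennreal_iff,
    VectorMeasure.ennrealToMeasure_toENNRealVectorMeasure]
  exact h.absolutelyContinuous

theorem fst_rnDeriv (μ : MeasPair Ω) :
    (refMeasure μ).withDensityᵥ (μ.1.rnDeriv (refMeasure μ)) = μ.1 :=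
  SignedMeasure.withDensityᵥ_rnDeriv_eq _ _
    (absolutelyContinuous_of_totalVariation_le (Measure.le_add_right le_rfl))

theorem coordMeasure_rnDeriv (μ : MeasPair Ω) (i : Fin d) :
    (refMeasure μ).withDensityᵥ ((coordMeasure μ.2 i).rnDeriv (refMeasure μ)) =
      coordMeasure μ.2 i :=
  SignedMeasure.withDensityᵥ_rnDeriv_eq _ _
    (absolutelyContinuous_of_totalVariation_le (Measure.le_add_left
      (Finset.single_le_sum (f := fun i => (coordMeasure μ.2 i).totalVariation)
        (fun _ _ => Measure.zero_le _) (Finset.mem_univ i))))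

theorem Psi_smul {r : ℝ} (hr : 0 ≤ r) (x : EuclideanSpace ℝ (Fin d)) :
    Psi r (r • x) = ENNReal.ofReal r * ENNReal.ofReal (‖x‖ ^ 2 / 2) := by
  rcases hr.eq_or_lt with rfl | hr'
  · simp [Psi]
  · rw [Psi, if_pos hr', ← ENNReal.ofReal_mul hr, norm_smul, Real.norm_of_nonneg hr]
    congr 1
    field_simp

/-- As `Ψ` is one-homogeneous, the density of `ρ` with respect to the reference measure factors
out of the integrand, and the chain rule for densities removes the reference measure. -/
theorem benamouBrenier_flowPair (ρ : Measure (Cyl Ω)) [IsFiniteMeasure ρ]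
    {v : Cyl Ω → EuclideanSpace ℝ (Fin d)} (hvm : Measurable v) (hv : Integrable v ρ) :
    benamouBrenier (flowPair ρ v) = ∫⁻ z, ENNReal.ofReal (‖v z‖ ^ 2 / 2) ∂ρ := by
  set μ := flowPair ρ v with hμ
  set lam := refMeasure μ with hlam
  have hle : ρ ≤ lam := by
    calc ρ = μ.1.totalVariation := (totalVariation_toSignedMeasure ρ).symm
      _ ≤ lam := Measure.le_add_right le_rfl
  have hac : ρ ≪ lam := hle.absolutelyContinuous
  have h1 : μ.1.rnDeriv lam =ᵐ[lam] fun z => (ρ.rnDeriv lam z).toReal := by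
    refine Integrable.ae_eq_of_withDensityᵥ_eq (SignedMeasure.integrable_rnDeriv _ _)
      Measure.integrable_toReal_rnDeriv ?_
    rw [fst_rnDeriv]
    ext A hA
    rw [withDensityᵥ_apply Measure.integrable_toReal_rnDeriv hA,
      Measure.setIntegral_toReal_rnDeriv hac]
    exact Measure.toSignedMeasure_apply_measurable hA
  have h2 : ∀ i, (coordMeasure μ.2 i).rnDeriv lam =ᵐ[lam]
      fun z => (ρ.rnDeriv lam z).toReal • v z i := by
    intro i
    have hvi : Integrable (fun z => v z i) ρ :=
      (EuclideanSpace.proj i : EuclideanSpace ℝ (Fin d) →L[ℝ] ℝ).integrable_comp hv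
    refine Integrable.ae_eq_of_withDensityᵥ_eq (SignedMeasure.integrable_rnDeriv _ _)
      ((integrable_rnDeriv_smul_iff hac).2 hvi) ?_
    rw [coordMeasure_rnDeriv, withDensityᵥ_rnDeriv_smul hac hvi]
    ext A hA
    rw [coordMeasure_apply, withDensityᵥ_apply hvi hA]
    change (ρ.withDensityᵥ v A) i = _
    rw [withDensityᵥ_apply hv hA]
    exact ((EuclideanSpace.proj i : EuclideanSpace ℝ (Fin d) →L[ℝ] ℝ).integral_comp_comm
      hv.integrableOn).symm
  have h3 : ∀ᵐ z ∂lam, Psi (μ.1.rnDeriv lam z)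
      (WithLp.toLp 2 fun i => (coordMeasure μ.2 i).rnDeriv lam z) =
      ρ.rnDeriv lam z * ENNReal.ofReal (‖v z‖ ^ 2 / 2) := by
    filter_upwards [h1, ae_all_iff.2 h2, ρ.rnDeriv_lt_top lam] with z hz1 hz2 hz3
    have : (WithLp.toLp 2 fun i => (coordMeasure μ.2 i).rnDeriv lam z) =
        (ρ.rnDeriv lam z).toReal • v z := by
      ext i
      simp [hz2 i]
    rw [this, hz1, Psi_smul ENNReal.toReal_nonneg, ENNReal.ofReal_toReal hz3.ne]
  rw [benamouBrenier, lintegral_congr_ae h3]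
  exact lintegral_rnDeriv_mul hac (by fun_prop)

/-- A pair of finite energy consists of a positive measure and its momentum for some velocity
field. -/
theorem exists_flowPair_of_benamouBrenier_lt_top {μ : MeasPair Ω} (h : benamouBrenier μ < ⊤) :
    ∃ (ρ : Measure (Cyl Ω)) (_ : IsFiniteMeasure ρ) (v : Cyl Ω → EuclideanSpace ℝ (Fin d)),
      Measurable v ∧ Integrable v ρ ∧ μ = flowPair ρ v := by
  set lam := refMeasure μ with hlam
  set s := μ.1.rnDeriv lam with hs
  set x : Cyl Ω → EuclideanSpace ℝ (Fin d) := fun z =>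
    WithLp.toLp 2 fun i => (coordMeasure μ.2 i).rnDeriv lam z with hx
  have hsm : Measurable s := SignedMeasure.measurable_rnDeriv _ _
  have hxm : Measurable x := by
    refine (WithLp.measurable_toLp 2 _).comp (measurable_pi_lambda _ fun i => ?_)
    exact SignedMeasure.measurable_rnDeriv _ _
  have hsi : Integrable s lam := SignedMeasure.integrable_rnDeriv _ _
  have hxi : Integrable x lam :=
    integrable_piLp_iff.2 fun i => SignedMeasure.integrable_rnDeriv _ _
  -- finiteness of `Ψ` forces the first density to be nonnegative, and the second to vanish with it
  have hfin : ∀ᵐ z ∂lam, 0 ≤ s z ∧ (s z = 0 → x z = 0) := by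
    have := ae_lt_top (measurable_Psi.comp (hsm.prodMk hxm)) h.ne
    filter_upwards [this] with z hz
    simp only [Function.comp, Psi] at hz
    split_ifs at hz with h1 h2
    · exact ⟨h1.le, fun h => absurd h h1.ne'⟩
    · exact ⟨h2.1.ge, fun _ => h2.2⟩
    · exact absurd hz (lt_irrefl _)
  have hρfin : IsFiniteMeasure (lam.withDensity fun z => ENNReal.ofReal (s z)) :=
    isFiniteMeasure_withDensity_ofReal hsi.2
  have hsx : (fun z => (ENNReal.ofReal (s z)).toReal • (s z)⁻¹ • x z) =ᵐ[lam] x := by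
    filter_upwards [hfin] with z hz
    rw [ENNReal.toReal_ofReal hz.1]
    by_cases h0 : s z = 0
    · simp [h0, hz.2 h0]
    · simp [smul_smul, h0]
  refine ⟨lam.withDensity fun z => ENNReal.ofReal (s z), hρfin, fun z => (s z)⁻¹ • x z,
    hsm.inv.smul hxm, ?_, Prod.ext ?_ ?_⟩
  · rw [integrable_withDensity_iff_integrable_smul' hsm.ennreal_ofReal (by simp)]
    exact hxi.congr hsx.symm
  · rw [← fst_rnDeriv μ]
    change _ = (lam.withDensity fun z => ENNReal.ofReal (s z)).toSignedMeasure
    rw [← withDensityᵥ_toReal hsm.ennreal_ofReal.aemeasurable]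
    · refine WithDensityᵥEq.congr_ae ?_
      filter_upwards [hfin] with z hz
      rw [ENNReal.toReal_ofReal hz.1]
    · exact (hasFiniteIntegral_iff_ofReal (hfin.mono fun z hz => hz.1)).1 hsi.2 |>.ne
  · change _ = (lam.withDensity fun z => ENNReal.ofReal (s z)).withDensityᵥ _
    rw [← withDensityᵥ_smul_eq_withDensityᵥ_withDensity' hsm.ennreal_ofReal.aemeasurable (by simp)
      (hxi.congr hsx.symm), WithDensityᵥEq.congr_ae hsx]
    ext A hA i
    rw [withDensityᵥ_apply hxi hA, ← coordMeasure_apply, ← coordMeasure_rnDeriv,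
      withDensityᵥ_apply (SignedMeasure.integrable_rnDeriv _ _) hA]
    exact ((EuclideanSpace.proj i : EuclideanSpace ℝ (Fin d) →L[ℝ] ℝ).integral_comp_comm
      hxi.integrableOn)

/-! ### The continuity equation in terms of a density and a velocity -/

/-- Test functions for the continuity equation. -/
structure IsTest (φ : ℝ × EuclideanSpace ℝ (Fin d) → ℝ) : Prop where
  smooth : ContDiff ℝ ∞ φ
  compact : HasCompactSupport φ
  supp : tsupport φ ⊆ Ioo (0 : ℝ) 1 ×ˢ univ

/-- The time derivative of a function of time and space. -/
noncomputable def timeDeriv (φ : ℝ × EuclideanSpace ℝ (Fin d) → ℝ)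
    (p : ℝ × EuclideanSpace ℝ (Fin d)) : ℝ :=
  fderiv ℝ φ p (1, 0)

/-- The spatial gradient of a function of time and space. -/
noncomputable def spaceGrad (φ : ℝ × EuclideanSpace ℝ (Fin d) → ℝ)
    (p : ℝ × EuclideanSpace ℝ (Fin d)) : EuclideanSpace ℝ (Fin d) :=
  (InnerProductSpace.toDual ℝ _).symm
    ((fderiv ℝ φ p).comp (ContinuousLinearMap.inr ℝ ℝ (EuclideanSpace ℝ (Fin d))))

variable {φ : ℝ × EuclideanSpace ℝ (Fin d) → ℝ}

theorem hasFDerivAt_of_smooth (h : ContDiff ℝ ∞ φ) (p : ℝ × EuclideanSpace ℝ (Fin d)) :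
    HasFDerivAt φ (fderiv ℝ φ p) p :=
  (h.differentiable (by simp) p).hasFDerivAt

theorem deriv_eq_timeDeriv (h : ContDiff ℝ ∞ φ) (t : ℝ) (y : EuclideanSpace ℝ (Fin d)) :
    deriv (fun s => φ (s, y)) t = timeDeriv φ (t, y) := by
  have := (hasFDerivAt_of_smooth h (t, y)).comp_hasDerivAt t
    ((hasDerivAt_id t).prodMk (hasDerivAt_const t y))
  exact this.deriv

theorem gradient_eq_spaceGrad (h : ContDiff ℝ ∞ φ) (t : ℝ) (y : EuclideanSpace ℝ (Fin d)) :
    gradient (fun y => φ (t, y)) y = spaceGrad φ (t, y) := by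
  have := (hasFDerivAt_of_smooth h (t, y)).comp y (hasFDerivAt_prodMk_right t y)
  unfold gradient spaceGrad
  congr 1
  exact this.fderiv

theorem continuous_timeDeriv (h : ContDiff ℝ ∞ φ) : Continuous (timeDeriv φ) :=
  (h.continuous_fderiv (by simp)).clm_apply continuous_const

theorem continuous_spaceGrad (h : ContDiff ℝ ∞ φ) : Continuous (spaceGrad φ) :=
  (InnerProductSpace.toDual ℝ _).symm.continuous.comp
    ((h.continuous_fderiv (by simp)).clm_comp continuous_const)

theorem IsTest.exists_bound (h : IsTest φ) :
    ∃ C, ∀ p, ‖timeDeriv φ p‖ ≤ C ∧ ‖spaceGrad φ p‖ ≤ C := by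
  obtain ⟨C, hC⟩ := (h.compact.fderiv (𝕜 := ℝ)).exists_bound_of_continuous
    (h.smooth.continuous_fderiv (by simp))
  refine ⟨C, fun p => ⟨?_, ?_⟩⟩
  · refine ((fderiv ℝ φ p).le_opNorm _).trans ?_
    have : ‖((1 : ℝ), (0 : EuclideanSpace ℝ (Fin d)))‖ = 1 := by simp [Prod.norm_def]
    rw [this, mul_one]
    exact hC p
  · rw [spaceGrad, LinearIsometryEquiv.norm_map]
    refine (ContinuousLinearMap.opNorm_comp_le _ _).trans ?_
    calc _ ≤ ‖fderiv ℝ φ p‖ * 1 := by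
          gcongr
          exact ContinuousLinearMap.norm_inr_le_one _ _ _
      _ ≤ C := by rw [mul_one]; exact hC p

/-- The point of `ℝ × ℝᵈ` underlying a point of the cylinder. -/
def toPoint (z : Cyl Ω) : ℝ × EuclideanSpace ℝ (Fin d) := (z.1, z.2)

theorem continuous_toPoint : Continuous (toPoint : Cyl Ω → _) := by
  unfold toPoint
  fun_prop

theorem continuityEquation_flowPair_iff (ρ : Measure (Cyl Ω)) [IsFiniteMeasure ρ]
    {v : Cyl Ω → EuclideanSpace ℝ (Fin d)} (hv : Integrable v ρ) :
    ContinuityEquation (flowPair ρ v) ↔ ∀ φ : ℝ × EuclideanSpace ℝ (Fin d) → ℝ, IsTest φ →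
      ∫ z, timeDeriv φ (toPoint z) + inner ℝ (spaceGrad φ (toPoint z)) (v z) ∂ρ = 0 := by
  have key : ∀ φ : ℝ × EuclideanSpace ℝ (Fin d) → ℝ, IsTest φ →
      (∫ᵛ z, deriv (fun s : ℝ => φ (s, (z.2 : EuclideanSpace ℝ (Fin d)))) (z.1 : ℝ)
          ∂•(flowPair ρ v).1) +
        (∫ᵛ z, gradient (fun y : EuclideanSpace ℝ (Fin d) => φ ((z.1 : ℝ), y))
          (z.2 : EuclideanSpace ℝ (Fin d)) ∂[innerSL ℝ; (flowPair ρ v).2]) =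
      ∫ z, timeDeriv φ (toPoint z) + inner ℝ (spaceGrad φ (toPoint z)) (v z) ∂ρ := by
    intro φ h
    obtain ⟨C, hC⟩ := h.exists_bound
    simp only [deriv_eq_timeDeriv h.smooth, gradient_eq_spaceGrad h.smooth]
    have hm := ((continuous_spaceGrad h.smooth).comp
      (continuous_toPoint (Ω := Ω))).stronglyMeasurable
    have h1 := integral_withDensityᵥ_vectorMeasure hv (innerSL ℝ) hm (fun z => (hC (toPoint z)).2)
    have hi := integrable_bilin_of_bounded hv (innerSL ℝ) hm (fun z => (hC (toPoint z)).2)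
    have hi' : Integrable (fun z : Cyl Ω => timeDeriv φ (toPoint z)) ρ :=
      Integrable.of_bound ((continuous_timeDeriv h.smooth).comp
        (continuous_toPoint (Ω := Ω))).aestronglyMeasurable C (ae_of_all _ fun z => (hC _).1)
    have h2 := integral_add hi' hi
    refine Eq.trans ?_ h2.symm
    congr 1
    exact integral_smul_toSignedMeasure ρ _
  constructor
  · intro h φ hφ
    rw [← key φ hφ]
    exact h φ hφ.1 hφ.2 hφ.3
  · intro h φ h1 h2 h3
    rw [key φ ⟨h1, h2, h3⟩]
    exact h φ ⟨h1, h2, h3⟩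

theorem J_flowPair (α β : ℝ) (ρ : Measure (Cyl Ω)) [IsFiniteMeasure ρ]
    {v : Cyl Ω → EuclideanSpace ℝ (Fin d)} (hvm : Measurable v) (hv : Integrable v ρ)
    (hce : ContinuityEquation (flowPair ρ v)) :
    J α β (flowPair ρ v) = ENNReal.ofReal β * ∫⁻ z, ENNReal.ofReal (‖v z‖ ^ 2 / 2) ∂ρ +
      ENNReal.ofReal α * ρ univ := by
  rw [J, if_pos hce, benamouBrenier_flowPair ρ hvm hv]
  congr 3
  exact totalVariation_toSignedMeasure ρ

/-- A pair on which `J` is finite consists of a positive measure and its momentum for a square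
integrable velocity field. -/
theorem exists_flowPair_of_J_lt_top {α β : ℝ} (hβ : 0 < β) {μ : MeasPair Ω} (h : J α β μ < ⊤) :
    ContinuityEquation μ ∧ ∃ (ρ : Measure (Cyl Ω)) (_ : IsFiniteMeasure ρ)
      (v : Cyl Ω → EuclideanSpace ℝ (Fin d)),
      Measurable v ∧ MemLp v 2 ρ ∧ μ = flowPair ρ v := by
  have hce : ContinuityEquation μ := by
    by_contra hce
    simp [J, hce] at h
  rw [J, if_pos hce, ENNReal.add_lt_top] at h
  have hb : benamouBrenier μ < ⊤ := by
    by_contra hb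
    rw [not_lt_top_iff.1 hb, ENNReal.mul_top (by simpa using hβ)] at h
    exact lt_irrefl _ h.1
  obtain ⟨ρ, hρ, v, hvm, hv, rfl⟩ := exists_flowPair_of_benamouBrenier_lt_top hb
  refine ⟨hce, ρ, hρ, v, hvm, ?_, rfl⟩
  rw [benamouBrenier_flowPair ρ hvm hv] at hb
  refine (memLp_two_iff_integrable_sq_norm hvm.aestronglyMeasurable).2 ?_
  have : Integrable (fun z => ‖v z‖ ^ 2 / 2) ρ :=
    ⟨by fun_prop, (hasFiniteIntegral_iff_ofReal (ae_of_all _ fun z => by positivity)).2 hb⟩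
  exact (this.mul_const 2).congr (ae_of_all _ fun z => by simp)

end Energy

/-! ### Distributional derivatives on the time interval -/

/-- Test functions on the open time interval. -/
structure IsTimeTest (η : ℝ → ℝ) : Prop where
  smooth : ContDiff ℝ ∞ η
  compact : HasCompactSupport η
  supp : tsupport η ⊆ Ioo (0 : ℝ) 1

namespace IsTimeTest

variable {η ζ : ℝ → ℝ}

theorem integrable (h : IsTimeTest η) : Integrable η :=
  h.smooth.continuous.integrable_of_hasCompactSupport h.compact

theorem exists_bound (h : IsTimeTest η) : ∃ C, ∀ t, ‖η t‖ ≤ C :=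
  h.compact.exists_bound_of_continuous h.smooth.continuous

theorem eq_zero (h : IsTimeTest η) {t : ℝ} (ht : t ∉ Ioo (0 : ℝ) 1) : η t = 0 :=
  image_eq_zero_of_notMem_tsupport fun h' => ht (h.supp h')

theorem sub_const_mul (h : IsTimeTest η) (h' : IsTimeTest ζ) (c : ℝ) :
    IsTimeTest fun t => η t - c * ζ t where
  smooth := h.smooth.sub (contDiff_const.mul h'.smooth)
  compact := h.compact.sub h'.compact.mul_left
  supp := by
    refine (tsupport_sub _ _).trans (union_subset h.supp ?_)
    exact (tsupport_mul_subset_right).trans h'.supp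

theorem exists_Icc (h : IsTimeTest η) :
    ∃ a b : ℝ, 0 < a ∧ a < b ∧ b < 1 ∧ ∀ t, t ∉ Icc a b → η t = 0 := by
  rcases (tsupport η).eq_empty_or_nonempty with he | hne
  · refine ⟨1 / 3, 1 / 2, by norm_num, by norm_num, by norm_num, fun t _ => ?_⟩
    exact image_eq_zero_of_notMem_tsupport (by simp [he])
  · obtain ⟨a, ha, ha'⟩ := h.compact.isCompact.exists_isLeast hne
    obtain ⟨b, hb, hb'⟩ := h.compact.isCompact.exists_isGreatest hne
    have h1 := h.supp ha
    have h2 := h.supp hb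
    refine ⟨a / 2, (b + 1) / 2, by linarith [h1.1], ?_, by linarith [h2.2], fun t ht => ?_⟩
    · linarith [h1.1, h1.2, h2.1]
    · refine image_eq_zero_of_notMem_tsupport fun h' => ht ⟨?_, ?_⟩
      · linarith [ha' h', h1.1]
      · linarith [hb' h', h2.2]

/-- A test function of integral zero is the derivative of a test function. -/
theorem primitive (h : IsTimeTest ζ) (h0 : ∫ t, ζ t = 0) :
    IsTimeTest (fun t => ∫ s in (0 : ℝ)..t, ζ s) ∧
      ∀ t, deriv (fun t => ∫ s in (0 : ℝ)..t, ζ s) t = ζ t := by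
  obtain ⟨a, b, ha, hab, hb, hz⟩ := h.exists_Icc
  have hd : ∀ t, HasDerivAt (fun t => ∫ s in (0 : ℝ)..t, ζ s) (ζ t) t := fun t =>
    intervalIntegral.integral_hasDerivAt_right h.integrable.intervalIntegrable
      (h.smooth.continuous.stronglyMeasurableAtFilter _ _) h.smooth.continuous.continuousAt
  have hderiv : deriv (fun t => ∫ s in (0 : ℝ)..t, ζ s) = ζ := funext fun t => (hd t).deriv
  have hout : ∀ t, t ∉ Icc a b → ∫ s in (0 : ℝ)..t, ζ s = 0 := by
    intro t ht
    rcases lt_or_ge t a with h1 | h1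
    · refine intervalIntegral.integral_zero_ae (ae_of_all _ fun s hs => hz s fun hs' => ?_)
      have : s ≤ max 0 t := hs.2
      exact absurd hs'.1 (not_le.2 (this.trans_lt (max_lt ha h1)))
    · have h2 : b < t := not_le.1 fun h2 => ht ⟨h1, h2⟩
      rw [intervalIntegral.integral_eq_integral_of_support_subset, h0]
      intro s hs
      have hs' : s ∈ Icc a b := by_contra fun h' => hs (hz s h')
      exact ⟨ha.trans_le hs'.1, hs'.2.trans h2.le⟩
  have hts : tsupport (fun t => ∫ s in (0 : ℝ)..t, ζ s) ⊆ Icc a b :=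
    closure_minimal (fun t ht => by_contra fun h' => ht (hout t h')) isClosed_Icc
  refine ⟨⟨?_, ?_, ?_⟩, fun t => (hd t).deriv⟩
  · refine contDiff_infty_iff_deriv.2 ⟨fun t => (hd t).differentiableAt, ?_⟩
    rw [hderiv]
    exact h.smooth
  · exact isCompact_Icc.of_isClosed_subset (isClosed_tsupport _) hts
  · exact hts.trans (Icc_subset_Ioo ha hb)

end IsTimeTest

theorem exists_isTimeTest_nonneg {t ε : ℝ} (hε : 0 < ε) (ht : Ioo (t - ε) (t + ε) ⊆ Ioo 0 1) :
    ∃ η, IsTimeTest η ∧ (∀ s, 0 ≤ η s) ∧ (∫ s, η s = 1) ∧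
      ∀ s, s ∉ Ioo (t - ε) (t + ε) → η s = 0 := by
  let f : ContDiffBump t := ⟨ε / 4, ε / 2, by linarith, by linarith⟩
  have hts : tsupport (f.normed volume) ⊆ Ioo (t - ε) (t + ε) := by
    rw [f.tsupport_normed_eq, ← Real.ball_eq_Ioo]
    exact Metric.closedBall_subset_ball (by change ε / 2 < ε; linarith)
  refine ⟨f.normed volume, ⟨f.contDiff_normed, f.hasCompactSupport_normed, hts.trans ht⟩,
    fun s => f.nonneg_normed s, f.integral_normed, fun s hs => ?_⟩
  exact image_eq_zero_of_notMem_tsupport fun h' => hs (hts h')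

section Weak

variable {X : Type*} [MeasurableSpace X] {ρ : Measure X} [IsFiniteMeasure ρ]
  {T : X → ℝ} {a b : X → ℝ}

omit [IsFiniteMeasure ρ] in
theorem integrable_comp_mul {η : ℝ → ℝ} (h : IsTimeTest η) (hT : Measurable T)
    (ha : Integrable a ρ) : Integrable (fun x => η (T x) * a x) ρ := by
  obtain ⟨C, hC⟩ := h.exists_bound
  exact ha.bdd_mul (h.smooth.continuous.measurable.comp hT).aestronglyMeasurable
    (ae_of_all _ fun x => hC (T x))

/-- The distribution function of the image under `T` of the measure with density `b`. -/
noncomputable def cumul (ρ : Measure X) (T b : X → ℝ) (t : ℝ) : ℝ :=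
  ∫ x, {x | T x < t}.indicator b x ∂ρ

/-- Fubini's theorem for `{T x < t}`. -/
theorem integral_mul_cumul (hT : Measurable T) (hb : Integrable b ρ) {ζ : ℝ → ℝ}
    (hζ : Integrable ζ) :
    Integrable (fun t => ζ t * cumul ρ T b t) ∧
    ∫ t, ζ t * cumul ρ T b t = ∫ x, (b x * ∫ s in Ioi (T x), ζ s) ∂ρ := by
  have hm : MeasurableSet {p : X × ℝ | T p.1 < p.2} :=
    measurableSet_lt (hT.comp measurable_fst) measurable_snd
  have hi : Integrable ({p : X × ℝ | T p.1 < p.2}.indicator fun p => b p.1 * ζ p.2)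
      (ρ.prod volume) := (hb.mul_prod hζ).indicator hm
  have e1 : ∀ t, ζ t * cumul ρ T b t =
      ∫ x, {p : X × ℝ | T p.1 < p.2}.indicator (fun p => b p.1 * ζ p.2) (x, t) ∂ρ := by
    intro t
    rw [cumul, ← integral_const_mul]
    congr 1 with x
    by_cases h : T x < t <;> simp [h, mul_comm]
  have e2 : ∀ x, b x * ∫ s in Ioi (T x), ζ s =
      ∫ t, {p : X × ℝ | T p.1 < p.2}.indicator (fun p => b p.1 * ζ p.2) (x, t) := by
    intro x
    rw [← integral_const_mul, ← integral_indicator measurableSet_Ioi]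
    rfl
  simp only [e1, e2]
  exact ⟨hi.integral_prod_right, (integral_integral_swap (f := fun x t =>
    {p : X × ℝ | T p.1 < p.2}.indicator (fun p => b p.1 * ζ p.2) (x, t)) hi).symm⟩

/-- If `b` is the distributional derivative in time of `a`, then the image in time of the measure
with density `a` has a density, which is up to a constant the distribution function of `b`. -/
theorem exists_const_of_weak_deriv (hT : Measurable T) (hT01 : ∀ x, T x ∈ Ioo (0 : ℝ) 1)
    (ha : Integrable a ρ) (hb : Integrable b ρ)
    (h : ∀ η, IsTimeTest η → ∫ x, deriv η (T x) * a x + η (T x) * b x ∂ρ = 0) :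
    ∃ c : ℝ, ∀ η, IsTimeTest η → ∫ x, η (T x) * a x ∂ρ = ∫ t, η t * (cumul ρ T b t + c) := by
  obtain ⟨ζ, hζ, -, hζ1, -⟩ := exists_isTimeTest_nonneg (t := 1 / 2) (ε := 1 / 2) (by norm_num)
    (by norm_num)
  have key : ∀ ξ, IsTimeTest ξ → ∫ t, ξ t = 0 →
      ∫ x, ξ (T x) * a x ∂ρ = ∫ t, ξ t * cumul ρ T b t := by
    intro ξ hξ h0
    obtain ⟨hZ, hZ'⟩ := hξ.primitive h0
    have h1 := h _ hZ
    simp only [hZ'] at h1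
    rw [integral_add (integrable_comp_mul hξ hT ha) (integrable_comp_mul hZ hT hb)] at h1
    rw [(integral_mul_cumul hT hb hξ.integrable).2, eq_neg_of_add_eq_zero_left h1, ← integral_neg]
    congr 1 with x
    -- the primitive of `ξ` at `T x` is minus the integral of `ξ` over `(T x, ∞)`
    have h2 : ∫ s in (0 : ℝ)..T x, ξ s = ∫ s in Iic (T x), ξ s := by
      rw [intervalIntegral.integral_of_le (hT01 x).1.le]
      refine (setIntegral_eq_of_subset_of_forall_sdiff_eq_zero measurableSet_Iic
        (fun s hs => hs.2) fun s hs => hξ.eq_zero fun hs' =>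
          absurd (show s ∈ Ioc 0 (T x) from ⟨hs'.1, hs.1⟩) hs.2).symm
    have h3 := intervalIntegral.integral_Iic_add_Ioi (b := T x) hξ.integrable.integrableOn
      hξ.integrable.integrableOn
    rw [h2, eq_neg_of_add_eq_zero_left (h3.trans h0)]
    ring
  -- a general `η` is reduced to integral zero by subtracting a multiple of the fixed bump `ζ`
  refine ⟨∫ x, ζ (T x) * a x ∂ρ - ∫ t, ζ t * cumul ρ T b t, fun η hη => ?_⟩
  have h1 := key _ (hη.sub_const_mul hζ (∫ t, η t)) (by
    rw [integral_sub hη.integrable (hζ.integrable.const_mul _), integral_const_mul, hζ1]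
    ring)
  have i1 := (integral_mul_cumul hT hb hη.integrable).1
  have i2 := (integral_mul_cumul hT hb hζ.integrable).1
  simp only [sub_mul, mul_assoc] at h1
  rw [integral_sub (integrable_comp_mul hη hT ha) ((integrable_comp_mul hζ hT ha).const_mul _),
    integral_sub i1 (i2.const_mul _), integral_const_mul, integral_const_mul] at h1
  simp only [mul_add]
  rw [integral_add i1 (hη.integrable.mul_const _), integral_mul_const]
  linarith

omit [IsFiniteMeasure ρ] in
/-- A distribution function is continuous if the levels of `T` are null sets. -/
theorem continuous_cumul (hT : Measurable T) (hb : Integrable b ρ) (h0 : ∀ t, ρ {x | T x = t} = 0) :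
    Continuous (cumul ρ T b) := by
  refine continuous_iff_continuousAt.2 fun t => ?_
  refine continuousAt_of_dominated (bound := fun x => ‖b x‖) ?_ ?_ hb.norm ?_
  · exact Eventually.of_forall fun s =>
      (hb.indicator (measurableSet_lt hT measurable_const)).aestronglyMeasurable
  · exact Eventually.of_forall fun s => ae_of_all _ fun x => norm_indicator_le_norm_self _ _
  · have : ∀ᵐ x ∂ρ, T x ≠ t := by
      rw [ae_iff]
      simpa using h0 t
    filter_upwards [this] with x hx
    rcases hx.lt_or_gt with h | h
    · refine (continuousAt_const (y := b x)).congr ?_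
      filter_upwards [lt_mem_nhds h] with s hs
      simp [indicator, hs]
    · refine (continuousAt_const (y := (0 : ℝ))).congr ?_
      filter_upwards [gt_mem_nhds h] with s hs
      simp [indicator, hs.le]

end Weak

/-- Finite measures on the open time interval are determined by test functions. -/
theorem ext_of_integral_timeTest {μ ν : Measure (Ioo (0 : ℝ) 1)} [IsFiniteMeasure μ]
    [IsFiniteMeasure ν] (h : ∀ η, IsTimeTest η → ∫ t, η t ∂μ = ∫ t, η t ∂ν) : μ = ν := by
  have hemb : MeasurableEmbedding (Subtype.val : Ioo (0 : ℝ) 1 → ℝ) :=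
    MeasurableEmbedding.subtype_coe measurableSet_Ioo
  -- both measures have densities with respect to their sum, and on the open interval test functions
  -- separate locally integrable functions
  set m := μ.map Subtype.val + ν.map (Subtype.val : Ioo (0 : ℝ) 1 → ℝ) with hm
  have h1 : μ.map Subtype.val ≪ m := (Measure.le_add_right le_rfl).absolutelyContinuous
  have h2 : ν.map Subtype.val ≪ m := (Measure.le_add_left le_rfl).absolutelyContinuous
  have hI : ∀ τ : Measure ℝ, IsFiniteMeasure τ → Integrable (fun t => (τ.rnDeriv m t).toReal) m :=
    fun τ _ => Measure.integrable_toReal_rnDeriv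
  have key := isOpen_Ioo.ae_eq_zero_of_integral_contDiff_smul_eq_zero (μ := m) (U := Ioo (0 : ℝ) 1)
    (f := fun t => ((μ.map Subtype.val).rnDeriv m t).toReal -
      ((ν.map Subtype.val).rnDeriv m t).toReal)
    (((hI _ inferInstance).sub (hI _ inferInstance)).locallyIntegrable.locallyIntegrableOn _) ?_
  · have hU : ∀ᵐ t ∂m, t ∈ Ioo (0 : ℝ) 1 := by
      rw [hm, ae_add_measure_iff]
      constructor <;>
        exact (ae_map_iff (by fun_prop) measurableSet_Ioo).2 (ae_of_all _ fun t => t.2)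
    have : μ.map Subtype.val = ν.map (Subtype.val : Ioo (0 : ℝ) 1 → ℝ) := by
      rw [← Measure.withDensity_rnDeriv_eq _ _ h1, ← Measure.withDensity_rnDeriv_eq _ _ h2]
      refine withDensity_congr_ae ?_
      filter_upwards [key, hU, (μ.map Subtype.val).rnDeriv_lt_top m,
        (ν.map Subtype.val).rnDeriv_lt_top m] with t ht hU h3 h4
      exact (ENNReal.toReal_eq_toReal_iff' h3.ne h4.ne).1 (sub_eq_zero.1 (ht hU))
    ext A hA
    have h' := congrArg (fun τ => τ (Subtype.val '' A)) this
    simpa only [hemb.map_apply, preimage_image_eq _ Subtype.val_injective] using h'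
  · intro g g1 g2 g3
    obtain ⟨C, hC⟩ := g2.exists_bound_of_continuous g1.continuous
    have hi : ∀ τ : Measure ℝ, IsFiniteMeasure τ →
        Integrable (fun t => g t * (τ.rnDeriv m t).toReal) m := fun τ hτ =>
      (hI τ hτ).bdd_mul g1.continuous.aestronglyMeasurable (ae_of_all _ hC)
    have hr : ∀ τ : Measure ℝ, IsFiniteMeasure τ → τ ≪ m →
        ∫ t, g t * (τ.rnDeriv m t).toReal ∂m = ∫ t, g t ∂τ := fun τ hτ hac => by
      simp only [mul_comm (g _)]
      exact integral_rnDeriv_smul hac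
    simp only [smul_eq_mul, mul_sub]
    rw [integral_sub (hi _ inferInstance) (hi _ inferInstance), hr _ inferInstance h1,
      hr _ inferInstance h2, hemb.integral_map, hemb.integral_map, h g ⟨g1, g2, g3⟩, sub_self]

/-! ### Time densities of solutions of the continuity equation -/

/-- The Lebesgue measure on the open time interval. -/
noncomputable abbrev lebIoo : Measure (Ioo (0 : ℝ) 1) := Measure.comap Subtype.val volume

theorem lebIoo_univ : lebIoo univ = 1 := by
  rw [(MeasurableEmbedding.subtype_coe measurableSet_Ioo).comap_apply, image_univ,
    Subtype.range_coe]
  simp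

instance : IsProbabilityMeasure lebIoo := ⟨lebIoo_univ⟩

theorem setIntegral_eq_integral_timeTest {η : ℝ → ℝ} (h : IsTimeTest η) (g : ℝ → ℝ) {s : Set ℝ}
    (hs : Ioo 0 1 ⊆ s) : ∫ t in s, η t * g t = ∫ t, η t * g t :=
  setIntegral_eq_integral_of_forall_compl_eq_zero fun t ht => by
    rw [h.eq_zero fun h' => ht (hs h'), zero_mul]

theorem integral_Ioo_timeTest {η : ℝ → ℝ} (h : IsTimeTest η) (g : ℝ → ℝ) :
    ∫ t : Ioo (0 : ℝ) 1, η t * g t ∂lebIoo = ∫ t, η t * g t := by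
  rw [integral_subtype_comap measurableSet_Ioo (fun t => η t * g t),
    setIntegral_eq_integral_timeTest h g le_rfl]

theorem integral_Icc_timeTest {η : ℝ → ℝ} (h : IsTimeTest η) (g : ℝ → ℝ) :
    ∫ t : I, η t * g t = ∫ t, η t * g t := by
  rw [unitInterval.volume_def, integral_subtype_comap measurableSet_Icc (fun t => η t * g t),
    setIntegral_eq_integral_timeTest h g Ioo_subset_Icc_self]

/-- Integrals over `[0,1]` and over `(0,1)` agree. -/
theorem integral_Icc_eq_integral_Ioo (g : I → ℝ) :
    ∫ t : I, g t = ∫ t : Ioo (0 : ℝ) 1, g (Set.inclusion Ioo_subset_Icc_self t) ∂lebIoo := by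
  have h1 : ∀ t : I, g t = (fun t : ℝ => g (projIcc 0 1 zero_le_one t)) t := fun t => by simp
  have h2 : ∀ t : Ioo (0 : ℝ) 1, g (Set.inclusion Ioo_subset_Icc_self t) =
      (fun t : ℝ => g (projIcc 0 1 zero_le_one t)) t := fun t => by
    simp only [projIcc_of_mem zero_le_one (Ioo_subset_Icc_self t.2)]
  rw [integral_congr_ae (ae_of_all _ h1), integral_congr_ae (ae_of_all _ h2),
    unitInterval.volume_def,
    integral_subtype_comap measurableSet_Icc (fun t : ℝ => g (projIcc 0 1 zero_le_one t)),
    integral_subtype_comap measurableSet_Ioo (fun t : ℝ => g (projIcc 0 1 zero_le_one t)),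
    MeasureTheory.integral_Icc_eq_integral_Ioo]

section Curve

variable {d : ℕ} {Ω : Set (EuclideanSpace ℝ (Fin d))}

/-- The cutoff equals `1` near `closure Ω`: it makes functions of space admissible in test functions
without changing them or their gradients on the cylinder. -/
theorem exists_cutoff (hΩ : Bornology.IsBounded Ω) : ∃ χ : EuclideanSpace ℝ (Fin d) → ℝ,
    ContDiff ℝ ∞ χ ∧ HasCompactSupport χ ∧ ∀ x ∈ closure Ω, χ =ᶠ[𝓝 x] 1 := by
  obtain ⟨R, hR, hΩR⟩ := hΩ.closure.subset_ball_lt 0 0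
  let f : ContDiffBump (0 : EuclideanSpace ℝ (Fin d)) := ⟨R, R + 1, hR, by linarith⟩
  exact ⟨f, f.contDiff, f.hasCompactSupport, fun x hx => f.eventuallyEq_one_of_mem_ball (hΩR hx)⟩

/-- The continuity equation tested with a product of a function of time and a function of space. -/
theorem ContinuityEquation.product (hΩ : Bornology.IsBounded Ω) {ρ : Measure (Cyl Ω)}
    [IsFiniteMeasure ρ] {v : Cyl Ω → EuclideanSpace ℝ (Fin d)} (hv : Integrable v ρ)
    (hce : ContinuityEquation (flowPair ρ v)) {k : EuclideanSpace ℝ (Fin d) → ℝ}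
    (hk : ContDiff ℝ ∞ k) {η : ℝ → ℝ} (hη : IsTimeTest η) :
    ∫ z : Cyl Ω, deriv η z.1 * k z.2 + η z.1 * inner ℝ (gradient k z.2) (v z) ∂ρ = 0 := by
  obtain ⟨χ, hχ, hχc, hχ1⟩ := exists_cutoff hΩ
  let φ : ℝ × EuclideanSpace ℝ (Fin d) → ℝ := fun p => η p.1 * (χ p.2 * k p.2)
  have hφs : ContDiff ℝ ∞ φ := (hη.smooth.comp contDiff_fst).mul
    ((hχ.comp contDiff_snd).mul (hk.comp contDiff_snd))
  have hts : tsupport φ ⊆ tsupport η ×ˢ tsupport χ := by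
    refine closure_minimal (fun p hp => ⟨subset_tsupport _ ?_, subset_tsupport _ ?_⟩)
      ((isClosed_tsupport _).prod (isClosed_tsupport _))
    · exact fun h => hp (by simp [φ, h])
    · exact fun h => hp (by simp [φ, h])
  have hφ : IsTest φ :=
    ⟨hφs, (hη.compact.isCompact.prod hχc.isCompact).of_isClosed_subset (isClosed_tsupport _) hts,
      hts.trans (prod_mono hη.supp (subset_univ _))⟩
  refine Eq.trans ?_ ((continuityEquation_flowPair_iff ρ hv).1 hce φ hφ)
  congr 1 with z
  have h1 : χ (z.2 : EuclideanSpace ℝ (Fin d)) = 1 := (hχ1 _ z.2.2).self_of_nhds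
  congr 1
  · rw [toPoint, ← deriv_eq_timeDeriv hφs]
    have := (((hη.smooth.differentiable (by simp)) (z.1 : ℝ)).hasDerivAt.mul_const
      (χ z.2 * k z.2)).deriv
    simp only [φ]
    rw [this, h1, one_mul]
  · rw [toPoint, ← gradient_eq_spaceGrad hφs]
    have hev : (fun y => φ ((z.1 : ℝ), y)) =ᶠ[𝓝 (z.2 : EuclideanSpace ℝ (Fin d))]
        fun y => η z.1 • k y := by
      filter_upwards [hχ1 _ z.2.2] with y hy
      simp [φ, hy]
    have hs : gradient (fun y => η z.1 • k y) (z.2 : EuclideanSpace ℝ (Fin d)) =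
        η z.1 • gradient k z.2 := by
      rw [gradient, fderiv_fun_const_smul (hk.differentiable (by simp) _), map_smul]
      rfl
    rw [hev.gradient_eq, hs, real_inner_smul_left]

/-- The function `G` is the density of the image in time of the measure `k ρ`. It is required to be
continuous on the closed interval, and thus determined at every time, not just at almost every
time. -/
def IsTimeDensity (ρ : Measure (Cyl Ω)) (k : C(closure Ω, ℝ)) (G : C(I, ℝ)) : Prop :=
  ∀ η, IsTimeTest η → ∫ z : Cyl Ω, η z.1 * k z.2 ∂ρ = ∫ t : I, η t * G t

theorem measurable_time : Measurable fun z : Cyl Ω => (z.1 : ℝ) :=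
  measurable_subtype_coe.comp measurable_fst

variable {ρ : Measure (Cyl Ω)} [IsFiniteMeasure ρ]

/-- The time marginal of a solution of the continuity equation is a multiple of the Lebesgue
measure. -/
theorem ContinuityEquation.map_fst (hΩ : Bornology.IsBounded Ω)
    {v : Cyl Ω → EuclideanSpace ℝ (Fin d)} (hv : Integrable v ρ)
    (hce : ContinuityEquation (flowPair ρ v)) :
    ρ.map Prod.fst = ρ univ • lebIoo := by
  have hT := measurable_time (Ω := Ω)
  obtain ⟨c, hc⟩ := exists_const_of_weak_deriv (ρ := ρ) (a := fun _ => 1) (b := fun _ => 0) hT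
    (fun z => z.1.2) (integrable_const _) (integrable_const _) (fun η hη => by
      have := hce.product hΩ hv (k := fun _ => 1) contDiff_const hη
      simpa using this)
  simp only [mul_one, cumul, indicator_zero, integral_zero, zero_add, integral_mul_const] at hc
  have hc0 : 0 ≤ c := by
    obtain ⟨η, hη, h0, h1, -⟩ := exists_isTimeTest_nonneg (t := 1 / 2) (ε := 1 / 2) (by norm_num)
      (by norm_num)
    have := hc η hη
    rw [h1, one_mul] at this
    rw [← this]
    exact integral_nonneg fun z => h0 _
  have key : ρ.map Prod.fst = c.toNNReal • lebIoo := by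
    refine ext_of_integral_timeTest fun η hη => ?_
    rw [integral_map measurable_fst.aemeasurable (f := fun t : Ioo (0 : ℝ) 1 => η t)
      (hη.smooth.continuous.comp continuous_subtype_val).aestronglyMeasurable,
      integral_smul_nnreal_measure]
    have := integral_Ioo_timeTest hη (fun _ => 1)
    simp only [mul_one] at this
    rw [this, NNReal.smul_def, Real.coe_toNNReal c hc0, smul_eq_mul, mul_comm, ← hc η hη]
  have huniv := congrArg (fun τ => τ univ) key
  simp only [Measure.map_apply measurable_fst MeasurableSet.univ, preimage_univ,
    Measure.smul_apply, lebIoo_univ, ENNReal.smul_def, smul_eq_mul, mul_one] at huniv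
  rw [key, huniv]
  rfl

omit [IsFiniteMeasure ρ] in
theorem measure_time_eq_zero (hmap : ρ.map Prod.fst = ρ univ • lebIoo)
    (t : ℝ) : ρ {z | (z.1 : ℝ) = t} = 0 := by
  by_cases ht : t ∈ Ioo (0 : ℝ) 1
  · have h1 : {z : Cyl Ω | (z.1 : ℝ) = t} = Prod.fst ⁻¹' {(⟨t, ht⟩ : Ioo (0 : ℝ) 1)} := by
      ext z
      simp [Subtype.ext_iff]
    rw [h1, ← Measure.map_apply measurable_fst (measurableSet_singleton _), hmap]
    have : lebIoo {⟨t, ht⟩} = 0 := by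
      rw [(MeasurableEmbedding.subtype_coe measurableSet_Ioo).comap_apply]
      simp
    simp [this]
  · have : {z : Cyl Ω | (z.1 : ℝ) = t} = ∅ := by
      ext z
      simp only [mem_ofPred_eq, mem_empty_iff_false, iff_false]
      rintro rfl
      exact ht z.1.2
    simp [this]

theorem integrable_comp_snd (k : C(closure Ω, ℝ)) (hΩ : Bornology.IsBounded Ω) :
    Integrable (fun z : Cyl Ω => k z.2) ρ := by
  have : CompactSpace (closure Ω) := isCompact_iff_compactSpace.1 hΩ.isCompact_closure
  exact Integrable.of_bound (by fun_prop) ‖k‖ (ae_of_all _ fun z => k.norm_coe_le_norm _)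

/-- Up to a constant, the density is the distribution function in time of the measure with density
`∇k · v`. It is continuous as the time marginal has no atoms. -/
theorem exists_timeDensity_of_smooth (hΩ : Bornology.IsBounded Ω)
    {v : Cyl Ω → EuclideanSpace ℝ (Fin d)} (hv : Integrable v ρ)
    (hce : ContinuityEquation (flowPair ρ v)) {k : EuclideanSpace ℝ (Fin d) → ℝ}
    (hk : ContDiff ℝ ∞ k) :
    ∃ G, IsTimeDensity ρ ⟨fun x => k x, hk.continuous.comp continuous_subtype_val⟩ G := by
  have hT := measurable_time (Ω := Ω)
  have : CompactSpace (closure Ω) := isCompact_iff_compactSpace.1 hΩ.isCompact_closure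
  have hgc : Continuous (gradient k) := (InnerProductSpace.toDual ℝ _).symm.continuous.comp
    (hk.continuous_fderiv (by simp))
  obtain ⟨C, hC⟩ := hΩ.isCompact_closure.exists_bound_of_continuousOn hgc.continuousOn
  have hb : Integrable (fun z : Cyl Ω => inner ℝ (gradient k z.2) (v z)) ρ :=
    integrable_bilin_of_bounded hv (innerSL ℝ) (hgc.comp
      (continuous_subtype_val.comp continuous_snd)).stronglyMeasurable fun z => hC _ z.2.2
  obtain ⟨c, hc⟩ := exists_const_of_weak_deriv hT (fun z => z.1.2)
    (integrable_comp_snd (ρ := ρ) ⟨fun x => k x, hk.continuous.comp continuous_subtype_val⟩ hΩ)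
    hb (fun η hη => hce.product hΩ hv hk hη)
  have hcont := continuous_cumul hT hb (measure_time_eq_zero (hce.map_fst hΩ hv))
  refine ⟨⟨fun t => cumul ρ (fun z : Cyl Ω => (z.1 : ℝ))
    (fun z : Cyl Ω => inner ℝ (gradient k z.2) (v z)) t + c,
    (hcont.comp continuous_subtype_val).add continuous_const⟩, fun η hη => ?_⟩
  exact (hc η hη).trans (integral_Icc_timeTest hη _).symm

end Curve

namespace IsTimeDensity

variable {d : ℕ} {Ω : Set (EuclideanSpace ℝ (Fin d))} {ρ : Measure (Cyl Ω)} [IsFiniteMeasure ρ]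
  {k k' : C(closure Ω, ℝ)} {G G' : C(I, ℝ)}

theorem integrable_left [CompactSpace (closure Ω)] {η : ℝ → ℝ} (hη : IsTimeTest η)
    (k : C(closure Ω, ℝ)) : Integrable (fun z : Cyl Ω => η z.1 * k z.2) ρ := by
  obtain ⟨C, hC⟩ := hη.exists_bound
  have h1 : Continuous fun z : Cyl Ω => η z.1 :=
    hη.smooth.continuous.comp (continuous_subtype_val.comp continuous_fst)
  refine Integrable.of_bound (h1.mul (by fun_prop)).aestronglyMeasurable (C * ‖k‖)
    (ae_of_all _ fun z => ?_)
  rw [norm_mul]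
  gcongr
  · exact (norm_nonneg _).trans (hC 0)
  · exact hC _
  · exact k.norm_coe_le_norm _

theorem integrable_right {η : ℝ → ℝ} (hη : IsTimeTest η) (G : C(I, ℝ)) :
    Integrable fun t : I => η t * G t := by
  have h1 : Continuous fun t : I => η t := hη.smooth.continuous.comp continuous_subtype_val
  exact Continuous.integrable_of_hasCompactSupport (h1.mul G.continuous)
    (HasCompactSupport.of_compactSpace _)

theorem add [CompactSpace (closure Ω)] (h : IsTimeDensity ρ k G) (h' : IsTimeDensity ρ k' G') :
    IsTimeDensity ρ (k + k') (G + G') := by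
  intro η hη
  simp only [ContinuousMap.add_apply, mul_add]
  rw [integral_add (integrable_left hη k) (integrable_left hη k'),
    integral_add (integrable_right hη G) (integrable_right hη G'), h η hη, h' η hη]

omit [IsFiniteMeasure ρ] in
theorem smul (h : IsTimeDensity ρ k G) (c : ℝ) : IsTimeDensity ρ (c • k) (c • G) := by
  intro η hη
  simp only [ContinuousMap.smul_apply, smul_eq_mul, mul_left_comm _ c]
  rw [integral_const_mul, integral_const_mul, h η hη]

theorem sub [CompactSpace (closure Ω)] (h : IsTimeDensity ρ k G) (h' : IsTimeDensity ρ k' G') :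
    IsTimeDensity ρ (k - k') (G - G') := by
  have := h.add (h'.smul (-1))
  simpa [sub_eq_add_neg] using this

omit [IsFiniteMeasure ρ] in
/-- If `G` were negative at some time, testing with a bump supported in `(0,1)` where `G < 0` would
give a contradiction. -/
theorem nonneg (h : IsTimeDensity ρ k G) (hk : ∀ x, 0 ≤ k x) (t₀ : I) : 0 ≤ G t₀ := by
  by_contra! hneg
  set g : ℝ → ℝ := fun t => G (projIcc 0 1 zero_le_one t) with hg
  have hgc : Continuous g := G.continuous.comp continuous_projIcc
  have hopen : IsOpen {t | g t < G t₀ / 2} := isOpen_lt hgc continuous_const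
  have hmem : (t₀ : ℝ) ∈ {t | g t < G t₀ / 2} := by
    simp only [hg, mem_ofPred_eq, projIcc_val]
    linarith
  have hcl : (t₀ : ℝ) ∈ closure (Ioo (0 : ℝ) 1) := by
    rw [closure_Ioo (by norm_num)]
    exact t₀.2
  obtain ⟨t₁, ht₁⟩ := mem_closure_iff.1 hcl _ hopen hmem
  obtain ⟨ε, hε, hball⟩ := Metric.isOpen_iff.1 (hopen.inter isOpen_Ioo) t₁ ht₁
  rw [Real.ball_eq_Ioo] at hball
  obtain ⟨η, hη, h0, h1, hout⟩ := exists_isTimeTest_nonneg hε (hball.trans inter_subset_right)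
  have e1 : 0 ≤ ∫ z : Cyl Ω, η z.1 * k z.2 ∂ρ :=
    integral_nonneg fun z => mul_nonneg (h0 _) (hk _)
  have e2 : ∫ t : I, η t * G t = ∫ t, η t * g t := by
    rw [← integral_Icc_timeTest hη]
    simp [hg]
  rw [h η hη, e2] at e1
  have hi : Integrable fun t => η t * g t :=
    (hη.smooth.continuous.mul hgc).integrable_of_hasCompactSupport hη.compact.mul_right
  have e3 : ∫ t, η t * g t ≤ ∫ t, η t * (G t₀ / 2) := by
    refine integral_mono hi (hη.integrable.mul_const _) fun t => ?_
    by_cases ht : t ∈ Ioo (t₁ - ε) (t₁ + ε)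
    · exact mul_le_mul_of_nonneg_left (hball ht).1.le (h0 t)
    · simp [hout t ht]
  rw [integral_mul_const, h1] at e3
  linarith

theorem unique [CompactSpace (closure Ω)] (h : IsTimeDensity ρ k G) (h' : IsTimeDensity ρ k G') :
    G = G' := by
  have h1 := (h.sub h').nonneg (by simp)
  have h2 := (h'.sub h).nonneg (by simp)
  ext t
  exact le_antisymm (sub_nonneg.1 (h2 t)) (sub_nonneg.1 (h1 t))

omit [IsFiniteMeasure ρ] in
theorem one (hmap : ρ.map Prod.fst = ρ univ • lebIoo) :
    IsTimeDensity ρ 1 (ContinuousMap.const I (ρ.real univ)) := by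
  intro η hη
  simp only [ContinuousMap.one_apply, mul_one, ContinuousMap.const_apply]
  have h1 := integral_map (μ := ρ) measurable_fst.aemeasurable (f := fun t : Ioo (0 : ℝ) 1 => η t)
      (hη.smooth.continuous.comp continuous_subtype_val).aestronglyMeasurable
  have h2 := integral_Ioo_timeTest hη fun _ => 1
  have h3 := integral_Icc_timeTest hη fun _ => 1
  simp only [mul_one] at h2 h3
  rw [← h1, hmap, integral_smul_measure, integral_mul_const, h2, h3, smul_eq_mul, mul_comm]
  rfl

/-- Comparison with the density of the constant function `‖k‖`. -/
theorem norm_le [CompactSpace (closure Ω)] (hmap : ρ.map Prod.fst = ρ univ • lebIoo)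
    (h : IsTimeDensity ρ k G) : ‖G‖ ≤ ρ.real univ * ‖k‖ := by
  have hk : ∀ x, -‖k‖ ≤ k x ∧ k x ≤ ‖k‖ := fun x => abs_le.1 (k.norm_coe_le_norm x)
  have h1 : ∀ t, 0 ≤ ‖k‖ * ρ.real univ - G t := (((one hmap).smul ‖k‖).sub h).nonneg fun x => by
    simpa using (hk x).2
  have h2 : ∀ t, 0 ≤ ‖k‖ * ρ.real univ + G t := (((one hmap).smul ‖k‖).add h).nonneg fun x => by
    simpa using neg_le_iff_add_nonneg'.1 (hk x).1
  refine (ContinuousMap.norm_le _ (by positivity)).2 fun t => abs_le.2 ⟨?_, ?_⟩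
  · linarith [h2 t]
  · linarith [h1 t]

theorem limit [CompactSpace (closure Ω)] {kn : ℕ → C(closure Ω, ℝ)} {Gn : ℕ → C(I, ℝ)}
    (h : ∀ n, IsTimeDensity ρ (kn n) (Gn n)) (hk : Tendsto kn atTop (𝓝 k))
    (hG : Tendsto Gn atTop (𝓝 G)) : IsTimeDensity ρ k G := by
  intro η hη
  obtain ⟨C, hC⟩ := hη.exists_bound
  obtain ⟨A, hA⟩ := hk.norm.bddAbove_range
  obtain ⟨B, hB⟩ := hG.norm.bddAbove_range
  have hC0 : 0 ≤ C := (norm_nonneg _).trans (hC 0)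
  have hA' : ∀ n, ‖kn n‖ ≤ A := fun n => hA ⟨n, rfl⟩
  have hB' : ∀ n, ‖Gn n‖ ≤ B := fun n => hB ⟨n, rfl⟩
  refine tendsto_nhds_unique (f := fun n => ∫ z : Cyl Ω, η z.1 * kn n z.2 ∂ρ) (l := atTop) ?_ ?_
  · refine tendsto_integral_of_dominated_convergence (fun _ => C * A) (fun n =>
        (integrable_left hη (kn n)).aestronglyMeasurable) (integrable_const _)
        (fun n => ae_of_all _ fun z => ?_) (ae_of_all _ fun z => ?_)
    · rw [norm_mul]
      exact mul_le_mul (hC _) (((kn n).norm_coe_le_norm _).trans (hA' n)) (norm_nonneg _) hC0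
    · exact tendsto_const_nhds.mul (hk.eval_const z.2)
  · simp only [h _ η hη]
    refine tendsto_integral_of_dominated_convergence (fun _ => C * B)
      (fun n => (integrable_right hη (Gn n)).aestronglyMeasurable)
      (integrable_const _) (fun n => ae_of_all _ fun t => ?_) (ae_of_all _ fun t => ?_)
    · rw [norm_mul]
      exact mul_le_mul (hC _) (((Gn n).norm_coe_le_norm _).trans (hB' n)) (norm_nonneg _) hC0
    · exact tendsto_const_nhds.mul (hG.eval_const t)

end IsTimeDensity

section Density

variable {d : ℕ} {Ω : Set (EuclideanSpace ℝ (Fin d))}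

/-- The subalgebra of restrictions to `closure Ω` of smooth functions. -/
def smoothSubalgebra (Ω : Set (EuclideanSpace ℝ (Fin d))) : Subalgebra ℝ C(closure Ω, ℝ) where
  carrier := {k | ∃ k' : EuclideanSpace ℝ (Fin d) → ℝ, ContDiff ℝ ∞ k' ∧ ∀ x, k x = k' x}
  mul_mem' := by
    rintro a b ⟨a', ha, ha'⟩ ⟨b', hb, hb'⟩
    exact ⟨fun x => a' x * b' x, ha.mul hb, fun x => by simp [ha', hb']⟩
  add_mem' := by
    rintro a b ⟨a', ha, ha'⟩ ⟨b', hb, hb'⟩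
    exact ⟨fun x => a' x + b' x, ha.add hb, fun x => by simp [ha', hb']⟩
  algebraMap_mem' r := ⟨fun _ => r, contDiff_const, fun x => by simp⟩

theorem smoothSubalgebra_topologicalClosure [CompactSpace (closure Ω)] :
    (smoothSubalgebra Ω).topologicalClosure = ⊤ := by
  refine ContinuousMap.subalgebra_topologicalClosure_eq_top_of_separatesPoints _ ?_
  intro x y hxy
  obtain ⟨i, hi⟩ : ∃ i, (x : EuclideanSpace ℝ (Fin d)) i ≠ (y : EuclideanSpace ℝ (Fin d)) i := by
    by_contra! h
    exact hxy (Subtype.ext (PiLp.ext h))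
  refine ⟨_, ⟨⟨fun z => (z : EuclideanSpace ℝ (Fin d)) i, by fun_prop⟩,
    ⟨fun z => z i, by fun_prop, fun z => rfl⟩, rfl⟩, hi⟩

variable {ρ : Measure (Cyl Ω)} [IsFiniteMeasure ρ]

/-- For a solution of the continuity equation, every `k ρ` has a continuous density in time: this
holds for smooth `k`, and the density depends continuously on `k`. -/
theorem exists_timeDensity (hΩ : Bornology.IsBounded Ω)
    {v : Cyl Ω → EuclideanSpace ℝ (Fin d)} (hv : Integrable v ρ)
    (hce : ContinuityEquation (flowPair ρ v)) (k : C(closure Ω, ℝ)) :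
    ∃ G, IsTimeDensity ρ k G := by
  have : CompactSpace (closure Ω) := isCompact_iff_compactSpace.1 hΩ.isCompact_closure
  have hmap := hce.map_fst hΩ hv
  have hk : k ∈ closure (smoothSubalgebra Ω : Set C(closure Ω, ℝ)) := by
    rw [← Subalgebra.topologicalClosure_coe, smoothSubalgebra_topologicalClosure]
    trivial
  obtain ⟨kn, hkn, hlim⟩ := mem_closure_iff_seq_limit.1 hk
  have : ∀ n, ∃ G, IsTimeDensity ρ (kn n) G := by
    intro n
    obtain ⟨k', hk', he⟩ := hkn n
    obtain ⟨G, hG⟩ := exists_timeDensity_of_smooth hΩ hv hce hk'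
    refine ⟨G, ?_⟩
    have : kn n = ⟨fun x => k' x, hk'.continuous.comp continuous_subtype_val⟩ :=
      ContinuousMap.ext he
    rwa [this]
  choose Gn hGn using this
  have hcau : CauchySeq Gn := by
    refine Metric.cauchySeq_iff'.2 fun ε hε => ?_
    obtain ⟨N, hN⟩ := Metric.cauchySeq_iff'.1 hlim.cauchySeq (ε / (ρ.real univ + 1))
      (by positivity)
    refine ⟨N, fun n hn => ?_⟩
    have h1 := IsTimeDensity.norm_le hmap ((hGn n).sub (hGn N))
    have h2 := hN n hn
    rw [dist_eq_norm] at h2 ⊢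
    calc _ ≤ ρ.real univ * ‖kn n - kn N‖ := h1
      _ ≤ (ρ.real univ + 1) * ‖kn n - kn N‖ := by gcongr; linarith
      _ < (ρ.real univ + 1) * (ε / (ρ.real univ + 1)) := by gcongr
      _ = ε := by field_simp
  obtain ⟨G, hG⟩ := cauchySeq_tendsto_of_complete hcau
  exact ⟨G, IsTimeDensity.limit hGn hlim hG⟩

end Density

/-! ### Narrowly continuous curves of measures -/

/-- The Riesz-Markov-Kakutani theorem on a compact space. -/
theorem exists_measure_of_nonneg {X : Type*} [TopologicalSpace X] [T2Space X] [CompactSpace X]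
    [MeasurableSpace X] [BorelSpace X] (Λ : C(X, ℝ) →ₗ[ℝ] ℝ)
    (hpos : ∀ k : C(X, ℝ), (∀ x, 0 ≤ k x) → 0 ≤ Λ k) :
    ∃ μ : Measure X, IsFiniteMeasure μ ∧ μ.Regular ∧ ∀ k : C(X, ℝ), ∫ x, k x ∂μ = Λ k := by
  let Λ' : CompactlySupportedContinuousMap X ℝ →ₚ[ℝ] ℝ := PositiveLinearMap.mk₀
    { toFun := fun f => Λ f.toContinuousMap
      map_add' := fun f g => map_add Λ f.toContinuousMap g.toContinuousMap
      map_smul' := fun c f => map_smul Λ c f.toContinuousMap }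
    fun f hf => hpos _ fun x => hf x
  refine ⟨RealRMK.rieszMeasure Λ', inferInstance, inferInstance, fun k => ?_⟩
  exact RealRMK.integral_rieszMeasure Λ' ⟨k, HasCompactSupport.of_compactSpace _⟩

/-- Narrowly continuous families of measures are Borel families. -/
theorem measurable_of_continuous_integral {S Y : Type*} [TopologicalSpace S] [MeasurableSpace S]
    [BorelSpace S] [HasOuterApproxClosed S] [TopologicalSpace Y] [MeasurableSpace Y]
    [OpensMeasurableSpace Y] {R : Y → Measure S} [∀ t, IsFiniteMeasure (R t)]
    (h : ∀ k : C(S, ℝ), Continuous fun t => ∫ x, k x ∂(R t)) : Measurable R := by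
  have key : ∀ F : Set S, IsClosed F → Measurable fun t => R t F := by
    intro F hF
    refine measurable_of_tendsto_metrizable (f := fun n t => ∫⁻ x, hF.apprSeq n x ∂(R t)) ?_
      (tendsto_pi_nhds.2 fun t => HasOuterApproxClosed.tendsto_lintegral_apprSeq hF (R t))
    intro n
    have : ∀ t, ∫⁻ x, hF.apprSeq n x ∂(R t) =
        ENNReal.ofReal (∫ x, ((hF.apprSeq n x : ℝ≥0) : ℝ) ∂(R t)) := by
      intro t
      rw [ofReal_integral_eq_lintegral_ofReal]
      · simp
      · exact Integrable.of_bound (by fun_prop) 1 (ae_of_all _ fun x => by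
          simpa using HasOuterApproxClosed.apprSeq_apply_le_one hF n x)
      · exact ae_of_all _ fun x => NNReal.coe_nonneg _
    simp only [this]
    exact (h ⟨fun x => hF.apprSeq n x, by fun_prop⟩).measurable.ennreal_ofReal
  exact Measurable.measure_of_isPiSystem
    ((BorelSpace.measurable_eq (α := S)).trans borel_eq_generateFrom_isClosed)
    isPiSystem_isClosed key (key _ isClosed_univ)

section Curve

variable {d : ℕ} {Ω : Set (EuclideanSpace ℝ (Fin d))} {ρ : Measure (Cyl Ω)} [IsFiniteMeasure ρ]

/-- For nonnegative `k`, the identity which defines a time density extends from smooth test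
functions to continuous functions of time. -/
theorem integral_mul_eq_of_timeDensity {k : C(closure Ω, ℝ)} {G : C(I, ℝ)}
    [CompactSpace (closure Ω)]
    (h : IsTimeDensity ρ k G) (hk : ∀ x, 0 ≤ k x) {f : Ioo (0 : ℝ) 1 → ℝ} (hf : Continuous f) :
    ∫ z, f z.1 * k z.2 ∂ρ = ∫ t, f t * G (Set.inclusion Ioo_subset_Icc_self t) ∂lebIoo := by
  have hkm : Measurable fun z : Cyl Ω => ENNReal.ofReal (k z.2) := by fun_prop
  have hGm : Measurable fun t : Ioo (0 : ℝ) 1 =>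
      ENNReal.ofReal (G (Set.inclusion Ioo_subset_Icc_self t)) :=
    (G.continuous.comp (continuous_inclusion _)).measurable.ennreal_ofReal
  set m₁ := (ρ.withDensity fun z => ENNReal.ofReal (k z.2)).map Prod.fst
  set m₂ := lebIoo.withDensity fun t => ENNReal.ofReal (G (Set.inclusion Ioo_subset_Icc_self t))
  have : IsFiniteMeasure (ρ.withDensity fun z => ENNReal.ofReal (k z.2)) :=
    isFiniteMeasure_withDensity_ofReal
      (Integrable.of_bound (by fun_prop) ‖k‖ (ae_of_all _ fun z => k.norm_coe_le_norm _)).2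
  have : IsFiniteMeasure m₂ := by
    refine isFiniteMeasure_withDensity_ofReal
      (Integrable.of_bound ?_ ‖G‖ (ae_of_all _ fun z => G.norm_coe_le_norm _)).2
    exact (G.continuous.comp (continuous_inclusion _)).aestronglyMeasurable
  have e1 : ∀ f : Ioo (0 : ℝ) 1 → ℝ, Continuous f → ∫ t, f t ∂m₁ = ∫ z, f z.1 * k z.2 ∂ρ := by
    intro f hf
    rw [integral_map measurable_fst.aemeasurable hf.aestronglyMeasurable,
      integral_withDensity_eq_integral_toReal_smul hkm (by simp)]
    simp only [ENNReal.toReal_ofReal (hk _), smul_eq_mul, mul_comm]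
  have e2 : ∀ f : Ioo (0 : ℝ) 1 → ℝ, ∫ t, f t ∂m₂ =
      ∫ t, f t * G (Set.inclusion Ioo_subset_Icc_self t) ∂lebIoo := by
    intro f
    rw [integral_withDensity_eq_integral_toReal_smul hGm (by simp)]
    simp only [ENNReal.toReal_ofReal (h.nonneg hk _), smul_eq_mul, mul_comm]
  rw [← e1 f hf, ← e2 f]
  congr 1
  refine ext_of_integral_timeTest fun η hη => ?_
  rw [e1 (fun t => η t) (hη.smooth.continuous.comp continuous_subtype_val), e2, h η hη,
    integral_Icc_eq_integral_Ioo]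

/-- A solution of the continuity equation is represented by a narrowly continuous curve: the value
at `t` of the time density of `k ρ` is a positive functional of `k`, that is, a measure. -/
theorem ContinuityEquation.exists_curve (hΩ : Bornology.IsBounded Ω)
    {v : Cyl Ω → EuclideanSpace ℝ (Fin d)} (hv : Integrable v ρ)
    (hce : ContinuityEquation (flowPair ρ v)) :
    ∃ r : I → SignedMeasure (closure Ω), NarrowlyContinuous r ∧
      Disintegrates ρ.toSignedMeasure r := by
  have : CompactSpace (closure Ω) := isCompact_iff_compactSpace.1 hΩ.isCompact_closure
  have hmap := hce.map_fst hΩ hv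
  choose G hG using exists_timeDensity hΩ hv hce
  have hR : ∀ t : I, ∃ μ : Measure (closure Ω), IsFiniteMeasure μ ∧ μ.Regular ∧
      ∀ k : C(closure Ω, ℝ), ∫ x, k x ∂μ = G k t := by
    intro t
    refine exists_measure_of_nonneg
      { toFun := fun k => G k t
        map_add' := fun k k' => by rw [(hG _).unique ((hG k).add (hG k')), ContinuousMap.add_apply]
        map_smul' := fun c k => by
          rw [(hG _).unique ((hG k).smul c), ContinuousMap.smul_apply, RingHom.id_apply] }
      fun k hk => (hG k).nonneg hk t
  choose R hRf _ hRi using hR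
  have hcont : ∀ k : C(closure Ω, ℝ), Continuous fun t => ∫ x, k x ∂(R t) := fun k => by
    simp only [hRi]
    exact (G k).continuous
  have hRm : Measurable R := measurable_of_continuous_integral hcont
  let κ : ProbabilityTheory.Kernel (Ioo (0 : ℝ) 1) (closure Ω) :=
    ⟨fun t => R (Set.inclusion Ioo_subset_Icc_self t),
      hRm.comp (continuous_inclusion Ioo_subset_Icc_self).measurable⟩
  have hmass : ∀ t, R t univ = ρ univ := by
    intro t
    have h1 := hRi t 1
    rw [(hG 1).unique (.one hmap)] at h1
    simp only [ContinuousMap.one_apply, integral_const, smul_eq_mul, mul_one,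
      ContinuousMap.const_apply] at h1
    exact (ENNReal.toReal_eq_toReal_iff' (measure_ne_top _ _) (measure_ne_top _ _)).1 h1
  have : ProbabilityTheory.IsFiniteKernel κ :=
    ⟨ρ univ, measure_lt_top _ _, fun t => (hmass _).le⟩
  have hcomp : lebIoo.compProd κ = ρ := by
    refine Measure.ext_of_integral_mul_boundedContinuousFunction fun f g => ?_
    have hint : ∀ (m : Measure (Cyl Ω)) [IsFiniteMeasure m] (g : C(closure Ω, ℝ)),
        Integrable (fun p : Cyl Ω => f p.1 * g p.2) m := fun m _ g =>
      Integrable.of_bound (by fun_prop) (‖f‖ * ‖g‖) (ae_of_all _ fun z => by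
        rw [norm_mul]
        exact mul_le_mul (f.norm_coe_le_norm _) (g.norm_coe_le_norm _) (norm_nonneg _)
          (norm_nonneg _))
    have hpos : ∀ g : C(closure Ω, ℝ), (∀ x, 0 ≤ g x) →
        ∫ p, f p.1 * g p.2 ∂(lebIoo.compProd κ) = ∫ p, f p.1 * g p.2 ∂ρ := by
      intro g hg
      rw [integral_mul_eq_of_timeDensity (hG g) hg f.continuous, Measure.integral_compProd]
      · congr 1 with t
        exact (integral_const_mul (f t) fun x => g x).trans (congrArg _ (hRi _ g))
      · exact hint _ g
    -- a continuous function is the difference of a nonnegative one and a nonnegative constant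
    have h1 := hpos (g.toContinuousMap + ContinuousMap.const _ ‖g‖) fun x => by
      simpa using neg_le_iff_add_nonneg.1 (abs_le.1 (g.norm_coe_le_norm x)).1
    have h2 := hpos (ContinuousMap.const _ ‖g‖) fun x => norm_nonneg g
    have h3 : ∀ (m : Measure (Cyl Ω)) [IsFiniteMeasure m], ∫ p, f p.1 * g p.2 ∂m =
        ∫ p, f p.1 * (g.toContinuousMap + ContinuousMap.const (closure Ω) ‖g‖ :
          C(closure Ω, ℝ)) p.2 ∂m -
          ∫ p, f p.1 * (ContinuousMap.const (closure Ω) ‖g‖) p.2 ∂m := by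
      intro m _
      rw [← integral_sub (hint m _) (hint m _)]
      congr 1 with p
      simp
      ring
    rw [h3, h3, h1, h2]
  refine ⟨fun t => (R t).toSignedMeasure, fun k => ?_, fun A hA => ?_, fun φ hφ => ?_⟩
  · simp only [integral_smul_toSignedMeasure]
    exact hcont k
  · simp only [Measure.toSignedMeasure_apply_measurable hA]
    exact ((Measure.measurable_coe hA).comp hRm).ennreal_toReal
  · rw [totalVariation_toSignedMeasure] at hφ
    simp only [integral_smul_toSignedMeasure]
    conv_lhs => rw [← hcomp]
    rw [Measure.integral_compProd (by rwa [hcomp])]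
    rfl

end Curve

/-! ### Forward operators and their pre-adjoints -/

section Operator

instance {X : Type*} [MeasurableSpace X] (μ : SignedMeasure X) :
    IsFiniteMeasure (VectorMeasure.variation μ) := by
  rw [← SignedMeasure.totalVariation_eq_variation]
  infer_instance

variable {S : Type*} [TopologicalSpace S] [CompactSpace S] [MeasurableSpace S] [BorelSpace S]
  [SecondCountableTopology S]
  {V : Type*} [NormedAddCommGroup V] [InnerProductSpace ℝ V]

omit [SecondCountableTopology S] in
theorem integrable_continuousMap (μ : SignedMeasure S) (k : C(S, ℝ)) :
    VectorMeasure.Integrable μ k :=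
  Integrable.of_bound k.continuous.aestronglyMeasurable ‖k‖
    (ae_of_all _ fun x => k.norm_coe_le_norm x)

/-- Integration of continuous functions against signed measures, as a bilinear map. -/
noncomputable def integralBilin (S : Type*) [TopologicalSpace S] [CompactSpace S]
    [MeasurableSpace S] [BorelSpace S] [SecondCountableTopology S] :
    C(S, ℝ) →ₗ[ℝ] SignedMeasure S →ₗ[ℝ] ℝ :=
  LinearMap.mk₂ ℝ (fun k μ => ∫ᵛ x, k x ∂•μ)
    (fun k k' μ => VectorMeasure.integral_fun_add (integrable_continuousMap μ k)
      (integrable_continuousMap μ k'))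
    (fun c k μ => VectorMeasure.integral_fun_smul μ _ c k)
    (fun k μ ν => VectorMeasure.integral_add_vectorMeasure (integrable_continuousMap μ k)
      (integrable_continuousMap ν k))
    (fun c k _ => VectorMeasure.integral_smul_vectorMeasure k c)

/-- A weak*-continuous functional on measures is a combination of the functionals defining the
topology, hence integration of a continuous function. -/
theorem exists_preadjoint {T : SignedMeasure S →ₗ[ℝ] V} (hT : WeakStarToWeakContinuous T) (h : V) :
    ∃ k : C(S, ℝ), ∀ μ : SignedMeasure S, inner ℝ (T μ) h = ∫ᵛ x, k x ∂•μ := by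
  let φ : SignedMeasure S →ₗ[ℝ] ℝ := (innerₗ V h).comp T
  have hφ : Continuous[⨅ k, TopologicalSpace.induced (integralBilin S k) inferInstance,
      inferInstance] φ := by
    have e : (⨅ k, TopologicalSpace.induced (integralBilin S k) inferInstance) = weakStar S := by
      rw [weakStar, ← induced_to_pi]
      rfl
    rw [e]
    have h1 : Continuous fun x : WeakSpace ℝ V => (topDualPairing ℝ V).flip x (innerSL ℝ h) :=
      WeakBilin.eval_continuous (topDualPairing ℝ V).flip (innerSL ℝ h)
    exact @Continuous.comp (SignedMeasure S) (WeakSpace ℝ V) ℝ (weakStar S) _ _ _ _ h1 hT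
  have hmem := (LinearMap.mem_span_iff_continuous φ).2 hφ
  rw [← LinearMap.coe_range, Submodule.span_eq] at hmem
  obtain ⟨k, hk⟩ := hmem
  refine ⟨k, fun μ => ?_⟩
  rw [real_inner_comm]
  exact (LinearMap.congr_fun hk μ).symm

theorem inner_eq_integral_preadjoint {T : SignedMeasure S →ₗ[ℝ] V}
    (hT : WeakStarToWeakContinuous T) (h : V) (μ : SignedMeasure S) :
    inner ℝ (T μ) h = ∫ᵛ x, preadjoint T h x ∂•μ := by
  rw [preadjoint, dif_pos (exists_preadjoint hT h)]
  exact (exists_preadjoint hT h).choose_spec μ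

variable [T2Space S]

theorem preadjoint_apply {T : SignedMeasure S →ₗ[ℝ] V} (hT : WeakStarToWeakContinuous T) (h : V)
    (x : S) : preadjoint T h x = inner ℝ (T (Measure.dirac x).toSignedMeasure) h := by
  rw [inner_eq_integral_preadjoint hT, integral_smul_toSignedMeasure, integral_dirac]

theorem norm_preadjoint_le {T : SignedMeasure S →ₗ[ℝ] V} (hT : WeakStarToWeakContinuous T) {C : ℝ}
    (hC0 : 0 ≤ C) (hC : ∀ μ : SignedMeasure S, ‖T μ‖ ≤ C * (μ.totalVariation univ).toReal) (h : V) :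
    ‖preadjoint T h‖ ≤ C * ‖h‖ := by
  refine (ContinuousMap.norm_le _ (by positivity)).2 fun x => ?_
  rw [preadjoint_apply hT]
  refine (norm_inner_le_norm _ _).trans ?_
  gcongr
  have := hC (Measure.dirac x).toSignedMeasure
  rwa [totalVariation_toSignedMeasure, measure_univ, ENNReal.toReal_one, mul_one] at this

/-- The norm of `T μ` is controlled by the norm of `μ` as a functional on continuous functions:
test `T μ` with itself and move `T` to the other side. -/
theorem norm_le_of_integral_le {T : SignedMeasure S →ₗ[ℝ] V} (hT : WeakStarToWeakContinuous T)
    {C : ℝ} (hC0 : 0 ≤ C) (hC : ∀ μ : SignedMeasure S, ‖T μ‖ ≤ C * (μ.totalVariation univ).toReal)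
    {μ : SignedMeasure S} {N : ℝ} (hN0 : 0 ≤ N)
    (hN : ∀ k : C(S, ℝ), |∫ᵛ x, k x ∂•μ| ≤ N * ‖k‖) : ‖T μ‖ ≤ C * N := by
  have h1 : ‖T μ‖ ^ 2 ≤ N * (C * ‖T μ‖) := by
    rw [← real_inner_self_eq_norm_sq, inner_eq_integral_preadjoint hT]
    refine (le_abs_self _).trans ((hN _).trans ?_)
    gcongr
    exact norm_preadjoint_le hT hC0 hC _
  by_contra! h2
  have h3 : 0 < ‖T μ‖ := (by positivity : 0 ≤ C * N).trans_lt h2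
  nlinarith

/-- By the uniform boundedness principle, narrowly continuous curves are bounded. -/
theorem NarrowlyContinuous.exists_bound {r : I → SignedMeasure S} (hr : NarrowlyContinuous r) :
    ∃ N : ℝ, 0 ≤ N ∧ ∀ t, ∀ k : C(S, ℝ), |∫ᵛ x, k x ∂•(r t)| ≤ N * ‖k‖ := by
  let g : I → C(S, ℝ) →L[ℝ] ℝ := fun t =>
    ((integralBilin S).flip (r t)).mkContinuous
      ((VectorMeasure.variation (r t)).real univ) fun k => by
        have := VectorMeasure.norm_integral_le_of_norm_le_const (μ := r t)
          (B := ContinuousLinearMap.lsmul ℝ ℝ) (f := k) (C := ‖k‖)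
          (ae_of_all _ fun x => k.norm_coe_le_norm x)
        refine this.trans ?_
        rw [mul_comm (Measure.real _ _)]
        gcongr
        refine mul_le_of_le_one_right (norm_nonneg _) (ContinuousLinearMap.opNorm_lsmul_le ..)
  obtain ⟨N, hN⟩ := banach_steinhaus (g := g) fun k => by
    obtain ⟨B, hB⟩ := isCompact_univ.exists_bound_of_continuousOn (hr k).continuousOn
    exact ⟨B, fun t => hB t (mem_univ t)⟩
  refine ⟨N, (norm_nonneg _).trans (hN 0), fun t k => ?_⟩
  exact ((g t).le_opNorm k).trans (by gcongr; exact hN t)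

end Operator

/-! ### Measurability of the dual variable -/

section Measurability

/-- The parameter is a simple function of `t`, so there are finitely many functions to glue. -/
theorem aemeasurable_simpleFunc_bind {Y Z : Type*} [MeasurableSpace Y] {m : Measure Y}
    (s : SimpleFunc Y Z) {F : Z → Y → ℝ} (hF : ∀ z, AEMeasurable (F z) m) :
    AEMeasurable (fun t => F (s t) t) m := by
  refine ⟨fun t => (hF (s t)).mk _ t, s.measurable_bind (fun z => (hF z).mk (F z)) fun z =>
    (hF z).measurable_mk, ?_⟩
  have : ∀ᵐ t ∂m, ∀ z ∈ s.range, F z t = (hF z).mk (F z) t :=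
    (Finset.eventually_all _).2 fun z _ => (hF z).ae_eq_mk
  filter_upwards [this] with t ht
  exact ht _ (s.mem_range_self t)

variable {D : Type*} [NormedAddCommGroup D] [NormedSpace ℝ D]
  {H : I → Type*} [∀ t, NormedAddCommGroup (H t)] [∀ t, InnerProductSpace ℝ (H t)]
  {i : ∀ t, D →L[ℝ] H t}

theorem StronglyMeasurableH.aemeasurable_inner (hH : AssumptionH i) {f g : ∀ t, H t}
    (hf : StronglyMeasurableH i f) (hg : StronglyMeasurableH i g) :
    AEMeasurable (fun t => inner ℝ (f t) (g t)) (volume : Measure I) := by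
  obtain ⟨s, hs⟩ := hf
  obtain ⟨s', hs'⟩ := hg
  refine aemeasurable_of_tendsto_metrizable_ae (u := atTop)
    (f := fun n t => inner ℝ (i t (s n t)) (i t (s' n t))) (fun n => ?_) ?_
  · exact aemeasurable_simpleFunc_bind ((s n).pair (s' n))
      (F := fun p t => inner ℝ (i t p.1) (i t p.2)) fun p => hH.meas p.1 p.2
  · filter_upwards [hs, hs'] with t h1 h2
    exact h1.inner h2

variable {S : Type*} [TopologicalSpace S] [CompactSpace S] [MeasurableSpace S] [BorelSpace S]
  [SecondCountableTopology S] [T2Space S] {K : ∀ t, SignedMeasure S →ₗ[ℝ] H t}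

omit [T2Space S] in
/-- Replace `r` by curves which take finitely many values and converge to `r` pointwise. -/
theorem AssumptionK.aemeasurable_inner_curve (hH : AssumptionH i) (hK : AssumptionK i K)
    (μ : SignedMeasure S) {r : I → SignedMeasure S} (hr : NarrowlyContinuous r) :
    AEMeasurable (fun t => inner ℝ (K t μ) (K t (r t))) (volume : Measure I) := by
  let q : ℕ → SimpleFunc I I := fun n => SimpleFunc.approxOn id measurable_id univ 0 (mem_univ _) n
  refine aemeasurable_of_tendsto_metrizable_ae (u := atTop)
    (f := fun n t => inner ℝ (K t μ) (K t (r (q n t)))) (fun n => ?_) ?_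
  · exact aemeasurable_simpleFunc_bind (q n) (F := fun z t => inner ℝ (K t μ) (K t (r z))) fun z =>
      (hK.meas μ).aemeasurable_inner hH (hK.meas (r z))
  · filter_upwards [hK.weak] with t ht
    have hq : Tendsto (fun n => q n t) atTop (𝓝 t) :=
      SimpleFunc.tendsto_approxOn measurable_id (mem_univ _) (subset_closure (mem_univ _))
    have h1 : ∀ s : I, inner ℝ (K t μ) (K t (r s)) =
        ∫ᵛ x, preadjoint (K t) (K t μ) x ∂•(r s) := fun s => by
      rw [real_inner_comm, inner_eq_integral_preadjoint ht]
    simp only [h1]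
    exact ((hr _).tendsto t).comp hq

theorem aemeasurable_dualVariable_apply (hH : AssumptionH i) (hK : AssumptionK i K)
    {f : ∀ t, H t} (hf : StronglyMeasurableH i f) {r : I → SignedMeasure S}
    (hr : NarrowlyContinuous r) (x : S) :
    AEMeasurable (fun t => dualVariable K f r t x) (volume : Measure I) := by
  have h1 := hK.aemeasurable_inner_curve hH (Measure.dirac x).toSignedMeasure hr
  have h2 := (hK.meas (Measure.dirac x).toSignedMeasure).aemeasurable_inner hH hf
  refine (h2.sub h1).congr ?_
  filter_upwards [hK.weak] with t ht
  simp only [dualVariable, ContinuousMap.neg_apply, preadjoint_apply ht, inner_sub_right,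
    Pi.sub_apply, neg_sub]

omit [MeasurableSpace S] [BorelSpace S] in
/-- On a separable compact space, evaluation at a dense sequence is an injective continuous map from
the Polish space of continuous functions, hence a Borel embedding: measurability into it can be
checked pointwise. -/
theorem aestronglyMeasurable_continuousMap {Y : Type*} [MeasurableSpace Y] {m : Measure Y}
    {w : Y → C(S, ℝ)} (hw : ∀ x, AEMeasurable (fun t => w t x) m) : AEStronglyMeasurable w m := by
  rcases isEmpty_or_nonempty S with hS | hS
  · have : Subsingleton C(S, ℝ) := ⟨fun a b => ContinuousMap.ext fun x => hS.elim x⟩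
    rw [Subsingleton.elim w fun _ => 0]
    exact aestronglyMeasurable_const
  borelize C(S, ℝ)
  let e : C(S, ℝ) → ℕ → ℝ := fun k n => k (TopologicalSpace.denseSeq S n)
  have hec : Continuous e := continuous_pi fun n => continuous_eval_const _
  have hei : Function.Injective e := fun a b hab => DFunLike.coe_injective
    ((TopologicalSpace.denseRange_denseSeq S).equalizer a.continuous b.continuous hab)
  have hem : MeasurableEmbedding e := hec.measurableEmbedding hei
  obtain ⟨g, hg, hge⟩ := hem.exists_measurable_extend measurable_id fun _ => inferInstance
  have h1 : AEMeasurable (e ∘ w) m := aemeasurable_pi_lambda _ fun n => hw _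
  have h2 := hg.comp_aemeasurable h1
  rw [← Function.comp_assoc, hge, Function.id_comp] at h2
  exact h2.aestronglyMeasurable

/-- The dual variable is Bochner integrable as a function with values in `C(S)`. -/
theorem integrable_dualVariable (hH : AssumptionH i) (hK : AssumptionK i K)
    {f : ∀ t, H t} (hf : MemL2H i f) {r : I → SignedMeasure S} (hr : NarrowlyContinuous r) :
    Integrable (dualVariable K f r) (volume : Measure I) := by
  refine ⟨aestronglyMeasurable_continuousMap
    (aemeasurable_dualVariable_apply hH hK hf.1 hr), ?_⟩
  obtain ⟨C, hC0, hC⟩ := hK.bound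
  obtain ⟨N, hN0, hN⟩ := hr.exists_bound
  have hb : ∀ᵐ t : I, ‖dualVariable K f r t‖ₑ ≤
      ENNReal.ofReal (C * (C * N)) + ENNReal.ofReal C * (1 + ‖f t‖ₑ ^ 2) := by
    filter_upwards [hK.weak, hC] with t ht hCt
    have h1 : ‖dualVariable K f r t‖ ≤ C * (C * N) + C * ‖f t‖ := by
      rw [dualVariable, norm_neg]
      refine (norm_preadjoint_le ht hC0.le hCt _).trans ?_
      rw [← mul_add]
      gcongr
      refine (norm_sub_le _ _).trans ?_
      gcongr
      exact norm_le_of_integral_le ht hC0.le hCt hN0 (hN t)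
    have h2 : ‖f t‖ₑ ≤ 1 + ‖f t‖ₑ ^ 2 := by
      rcases le_total ‖f t‖ₑ 1 with h | h
      · exact h.trans le_self_add
      · exact (le_self_pow h two_ne_zero).trans le_add_self
    calc ‖dualVariable K f r t‖ₑ = ENNReal.ofReal ‖dualVariable K f r t‖ := (ofReal_norm _).symm
      _ ≤ ENNReal.ofReal (C * (C * N) + C * ‖f t‖) := ENNReal.ofReal_le_ofReal h1
      _ = ENNReal.ofReal (C * (C * N)) + ENNReal.ofReal C * ‖f t‖ₑ := by
        rw [ENNReal.ofReal_add (by positivity) (by positivity),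
          ENNReal.ofReal_mul hC0.le (q := ‖f t‖), ofReal_norm]
      _ ≤ _ := by gcongr
  refine (lintegral_mono_ae hb).trans_lt ?_
  rw [lintegral_add_left measurable_const, lintegral_const_mul' _ _ ENNReal.ofReal_ne_top,
    lintegral_add_left measurable_const, lintegral_const, lintegral_const, measure_univ]
  refine ENNReal.add_lt_top.2 ⟨by simp, ENNReal.mul_lt_top (by simp) ?_⟩
  exact ENNReal.add_lt_top.2 ⟨by simp, hf.2⟩

end Measurability

/-! ### The pairing of a flow with an integrable family of continuous functions -/

theorem map_inclusion_le :
    lebIoo.map (Set.inclusion Ioo_subset_Icc_self) ≤ (volume : Measure I) := by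
  refine Measure.le_iff.2 fun A hA => ?_
  rw [Measure.map_apply (continuous_inclusion Ioo_subset_Icc_self).measurable hA,
    (MeasurableEmbedding.subtype_coe measurableSet_Ioo).comap_apply, unitInterval.volume_def,
    (MeasurableEmbedding.subtype_coe measurableSet_Icc).comap_apply]
  refine measure_mono ?_
  rintro _ ⟨t, ht, rfl⟩
  exact ⟨_, ht, rfl⟩

theorem integrable_comp_inclusion {E : Type*} [NormedAddCommGroup E] {w : I → E}
    (hw : Integrable w volume) :
    Integrable (fun t => w (Set.inclusion Ioo_subset_Icc_self t)) lebIoo :=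
  (hw.mono_measure map_inclusion_le).comp_measurable
    (continuous_inclusion Ioo_subset_Icc_self).measurable

section Pairing

variable {d : ℕ} {Ω : Set (EuclideanSpace ℝ (Fin d))}

/-- The function `(t, x) ↦ w_t(x)` on the cylinder. -/
def cylFun (w : I → C(closure Ω, ℝ)) (z : Cyl Ω) : ℝ :=
  w (Set.inclusion Ioo_subset_Icc_self z.1) z.2

variable {ρ : Measure (Cyl Ω)} [IsFiniteMeasure ρ] {w : I → C(closure Ω, ℝ)}

/-- Integrals of functions of time against a measure with uniform time marginal. -/
theorem integral_comp_fst {g : Ioo (0 : ℝ) 1 → ℝ} (hmap : ρ.map Prod.fst = ρ univ • lebIoo)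
    (hg : Integrable g lebIoo) : Integrable (fun z : Cyl Ω => g z.1) ρ ∧
      ∫ z, g z.1 ∂ρ = ρ.real univ * ∫ t, g t ∂lebIoo := by
  have h1 : Integrable g (ρ.map Prod.fst) := by
    rw [hmap]
    exact hg.smul_measure (measure_ne_top _ _)
  refine ⟨h1.comp_measurable measurable_fst, ?_⟩
  rw [← integral_map measurable_fst.aemeasurable h1.aestronglyMeasurable, hmap,
    integral_smul_measure, smul_eq_mul]
  rfl

theorem integrable_cylFun [CompactSpace (closure Ω)] (hmap : ρ.map Prod.fst = ρ univ • lebIoo)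
    (hw : Integrable w volume) : Integrable (cylFun w) ρ := by
  have h1 := integrable_comp_inclusion hw
  refine (integral_comp_fst hmap h1.norm).1.mono' ?_ (ae_of_all _ fun z =>
    (w _).norm_coe_le_norm _)
  have h2 : AEStronglyMeasurable (fun t => w (Set.inclusion Ioo_subset_Icc_self t))
      (ρ.map Prod.fst) := by
    rw [hmap]
    exact h1.aestronglyMeasurable.smul_measure _
  exact (continuous_eval (F := C(closure Ω, ℝ))).comp_aestronglyMeasurable
    ((h2.comp_measurable measurable_fst).prodMk
      continuous_snd.aestronglyMeasurable)

theorem abs_integral_cylFun_le [CompactSpace (closure Ω)]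
    (hmap : ρ.map Prod.fst = ρ univ • lebIoo) (hw : Integrable w volume) :
    |∫ z, cylFun w z ∂ρ| ≤ ρ.real univ * ∫ t, ‖w t‖ := by
  have h1 := integral_comp_fst hmap (integrable_comp_inclusion hw).norm
  rw [integral_Icc_eq_integral_Ioo, ← h1.2]
  exact norm_integral_le_of_norm_le h1.1 (ae_of_all _ fun z => (w _).norm_coe_le_norm _)

/-- The disintegration is applied to the function `w` itself, which is only integrable. -/
theorem pairing_flowPair [CompactSpace (closure Ω)] (hΩ : Bornology.IsBounded Ω)
    {v : Cyl Ω → EuclideanSpace ℝ (Fin d)} (hv : Integrable v ρ)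
    (hce : ContinuityEquation (flowPair ρ v)) (hw : Integrable w volume) :
    pairing (flowPair ρ v).1 w = ((∫ z, cylFun w z ∂ρ : ℝ) : EReal) := by
  have h : ∃ r, NarrowlyContinuous r ∧ Disintegrates (flowPair ρ v).1 r := hce.exists_curve hΩ hv
  rw [pairing, dif_pos h]
  have h1 := h.choose_spec.2.2 (cylFun w) (by
    rw [flowPair, totalVariation_toSignedMeasure]
    exact integrable_cylFun (hce.map_fst hΩ hv) hw)
  have h2 : ∫ᵛ z, cylFun w z ∂•(flowPair ρ v).1 = ∫ z, cylFun w z ∂ρ :=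
    integral_smul_toSignedMeasure ρ _
  rw [← h2, h1, integral_Icc_eq_integral_Ioo]
  rfl

theorem flowPair_zero : flowPair (0 : Measure (Cyl Ω)) 0 = 0 := by
  simp [flowPair]

theorem continuityEquation_zero : ContinuityEquation (0 : MeasPair Ω) := by
  rw [← flowPair_zero, continuityEquation_flowPair_iff _ (integrable_zero _ _ _)]
  simp

theorem J_zero (α β : ℝ) : J α β (0 : MeasPair Ω) = 0 := by
  rw [← flowPair_zero, J_flowPair _ _ _ measurable_zero (integrable_zero _ _ _)
    (flowPair_zero ▸ continuityEquation_zero)]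
  simp

theorem pairing_zero [CompactSpace (closure Ω)] (hΩ : Bornology.IsBounded Ω)
    (hw : Integrable w volume) : pairing (0 : MeasPair Ω).1 w = 0 := by
  rw [← flowPair_zero, pairing_flowPair hΩ (integrable_zero _ _ _)
    (flowPair_zero ▸ continuityEquation_zero) hw]
  simp

/-- The zero measure is only represented by curves which are zero as functionals on continuous
functions. -/
theorem Disintegrates.integral_eq_zero [CompactSpace (closure Ω)]
    {r : I → SignedMeasure (closure Ω)}
    (hr : Disintegrates 0 r) (hc : NarrowlyContinuous r) (t : I) (k : C(closure Ω, ℝ)) :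
    ∫ᵛ x, k x ∂•(r t) = 0 := by
  have h1 : IsTimeDensity (0 : Measure (Cyl Ω)) k ⟨fun t => ∫ᵛ x, k x ∂•(r t), hc k⟩ := by
    intro η hη
    have h2 := hr.2 (fun z => η z.1 * k z.2) (by
      rw [SignedMeasure.totalVariation_zero]
      exact integrable_zero_measure)
    rw [integral_zero_measure, integral_Icc_eq_integral_Ioo]
    rw [VectorMeasure.integral_zero_vectorMeasure] at h2
    refine h2.trans (integral_congr_ae (ae_of_all _ fun t => ?_))
    exact VectorMeasure.integral_fun_smul _ _ (η t) k
  have h2 : IsTimeDensity (0 : Measure (Cyl Ω)) k 0 := fun η hη => by simp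
  exact congrArg (· t) (h1.unique h2)

variable {D : Type*} [NormedAddCommGroup D] [NormedSpace ℝ D]
  {H : I → Type*} [∀ t, NormedAddCommGroup (H t)] [∀ t, InnerProductSpace ℝ (H t)]
  {i : ∀ t, D →L[ℝ] H t} {K : ∀ t, SignedMeasure (closure Ω) →ₗ[ℝ] H t}

/-- The curve representing the zero measure is invisible to almost every `K_t`, so that the fidelity
of `0` is half the squared norm of `f`. -/
theorem Mzero_lt_top (hΩ : Bornology.IsBounded Ω) (α β : ℝ) (hK : AssumptionK i K) {f : ∀ t, H t}
    (hf : MemL2H i f) : Mzero α β K f < ⊤ := by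
  have : CompactSpace (closure Ω) := isCompact_iff_compactSpace.1 hΩ.isCompact_closure
  have h : ∃ r, NarrowlyContinuous r ∧ Disintegrates (0 : MeasPair Ω).1 r := by
    have h1 : ContinuityEquation (flowPair (0 : Measure (Cyl Ω)) 0) :=
      flowPair_zero ▸ continuityEquation_zero
    have := h1.exists_curve hΩ (integrable_zero _ _ _)
    simpa using this
  rw [Mzero, tikhonov, J_zero, add_zero, fidelity, dif_pos h]
  refine ENNReal.mul_lt_top (by simp) (lt_of_eq_of_lt (lintegral_congr_ae ?_) hf.2)
  obtain ⟨C, hC0, hC⟩ := hK.bound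
  filter_upwards [hK.weak, hC] with t ht hCt
  have h1 := norm_le_of_integral_le (μ := h.choose t) ht hC0.le hCt le_rfl fun k => by
    simp [h.choose_spec.2.integral_eq_zero h.choose_spec.1 t k]
  rw [mul_zero, norm_le_zero_iff] at h1
  rw [h1, zero_sub, enorm_neg]

end Pairing

/-! ### Maximizing over a set with compact affine image -/

/-- A function which is uniformly approximated by continuous linear functionals of an injective
affine image attains its maximum at an extreme point, if the image is compact. Convexity of the set
is not needed. -/
theorem exists_extremePoint_forall_le {M V : Type*} [AddCommGroup M] [Module ℝ M]
    [AddCommGroup V] [Module ℝ V] [TopologicalSpace V] [T2Space V] [IsTopologicalAddGroup V]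
    [ContinuousSMul ℝ V] [LocallyConvexSpace ℝ V] {C : Set M} {Φ : M → V}
    (hΦ : ∀ x ∈ C, ∀ y ∈ C, ∀ a b : ℝ, Φ (a • x + b • y) = a • Φ x + b • Φ y)
    (hinj : InjOn Φ C) (hcomp : IsCompact (Φ '' C)) (hne : C.Nonempty) {L : M → ℝ}
    (hL : ∀ ε > 0, ∃ g : V →L[ℝ] ℝ, ∀ x ∈ C, |L x - g (Φ x)| ≤ ε) :
    ∃ x ∈ C.extremePoints ℝ, ∀ y ∈ C, L y ≤ L x := by
  let L' : V → ℝ := fun v => L (Function.invFunOn Φ C v)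
  have hL' : ∀ x ∈ C, L' (Φ x) = L x := fun x hx => by
    simp only [L']
    rw [hinj.leftInvOn_invFunOn hx]
  have happ : ∀ ε > 0, ∃ g : V →L[ℝ] ℝ, ∀ v ∈ Φ '' C, |L' v - g v| ≤ ε := by
    intro ε hε
    obtain ⟨g, hg⟩ := hL ε hε
    refine ⟨g, ?_⟩
    rintro _ ⟨x, hx, rfl⟩
    rw [hL' x hx]
    exact hg x hx
  have hcont : ContinuousOn L' (Φ '' C) := by
    refine continuousOn_of_uniform_approx_of_continuousOn fun u hu => ?_
    obtain ⟨ε, hε, hεu⟩ := Metric.mem_uniformity_dist.1 hu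
    obtain ⟨g, hg⟩ := happ (ε / 2) (half_pos hε)
    exact ⟨g, g.continuous.continuousOn, fun v hv => hεu ((hg v hv).trans_lt (half_lt_self hε))⟩
  have haff : ∀ v ∈ Φ '' C, ∀ v₁ ∈ Φ '' C, ∀ v₂ ∈ Φ '' C, ∀ a b : ℝ, 0 < a → 0 < b → a + b = 1 →
      a • v₁ + b • v₂ = v → L' v = a * L' v₁ + b * L' v₂ := by
    intro v hv v₁ hv₁ v₂ hv₂ a b ha hb hab h
    refine eq_of_abs_sub_le_all fun ε hε => ?_
    obtain ⟨g, hg⟩ := happ (ε / 2) (half_pos hε)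
    have h0 := abs_le.1 (hg v hv)
    have h1 := abs_le.1 (hg v₁ hv₁)
    have h2 := abs_le.1 (hg v₂ hv₂)
    have h3 : g v = a * g v₁ + b * g v₂ := by simp [← h]
    obtain rfl : b = 1 - a := by linarith
    rw [h3] at h0
    rw [abs_le]
    constructor <;> nlinarith
  obtain ⟨m, hm, hmax⟩ := hcomp.exists_isMaxOn (hne.image Φ) hcont
  -- the maximizers form a compact face
  let F : Set V := Φ '' C ∩ L' ⁻¹' {L' m}
  have hF : IsCompact F := hcomp.of_isClosed_subset
    (hcont.preimage_isClosed_of_isClosed hcomp.isClosed isClosed_singleton) inter_subset_left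
  obtain ⟨v, hv⟩ := hF.extremePoints_nonempty ⟨m, hm, rfl⟩
  have hface : IsExtreme ℝ (Φ '' C) F := by
    refine ⟨inter_subset_left, ?_⟩
    rintro v₁ hv₁ v₂ hv₂ u ⟨hu, hu'⟩ ⟨a, b, ha, hb, hab, h⟩
    refine ⟨hv₁, le_antisymm (hmax hv₁) ?_⟩
    have h1 := haff u hu v₁ hv₁ v₂ hv₂ a b ha hb hab h
    have h2 : L' v₂ ≤ L' m := hmax hv₂
    have h3 : L' u = L' m := hu'
    change L' m ≤ L' v₁
    obtain rfl : b = 1 - a := by linarith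
    nlinarith
  have hve := hface.extremePoints_subset_extremePoints hv
  obtain ⟨⟨x, hx, rfl⟩, hxm⟩ := (extremePoints_subset hv : v ∈ F)
  refine ⟨x, mem_extremePoints_iff_left.2 ⟨hx, ?_⟩, fun y hy => ?_⟩
  · rintro x₁ hx₁ x₂ hx₂ ⟨a, b, ha, hb, hab, h⟩
    refine hinj hx₁ hx ?_
    refine (mem_extremePoints_iff_left.1 hve).2 _ (mem_image_of_mem Φ hx₁) _
      (mem_image_of_mem Φ hx₂) ⟨a, b, ha, hb, hab, ?_⟩
    rw [← hΦ x₁ hx₁ x₂ hx₂, h]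
  · rw [← hL' x hx, ← hL' y hy, show L' (Φ x) = L' m from hxm]
    exact hmax (mem_image_of_mem Φ hy)

/-! ### The closed cylinder -/

section Slab

variable {d : ℕ} {Ω : Set (EuclideanSpace ℝ (Fin d))}

/-- The compact cylinder `[0,1] × closure Ω`. -/
abbrev Slab (Ω : Set (EuclideanSpace ℝ (Fin d))) : Type := I × closure Ω

/-- The inclusion of the cylinder in the compact cylinder. -/
def toSlab (z : Cyl Ω) : Slab Ω := (Set.inclusion Ioo_subset_Icc_self z.1, z.2)

theorem continuous_toSlab : Continuous (toSlab : Cyl Ω → Slab Ω) :=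
  ((continuous_inclusion Ioo_subset_Icc_self).comp continuous_fst).prodMk continuous_snd

theorem range_toSlab : range (toSlab : Cyl Ω → Slab Ω) = {y | (y.1 : ℝ) ∈ Ioo (0 : ℝ) 1} := by
  ext y
  constructor
  · rintro ⟨z, rfl⟩
    exact z.1.2
  · intro hy
    exact ⟨(⟨y.1, hy⟩, y.2), rfl⟩

theorem measurableEmbedding_toSlab : MeasurableEmbedding (toSlab : Cyl Ω → Slab Ω) := by
  have h : IsEmbedding (toSlab : Cyl Ω → Slab Ω) :=
    (IsEmbedding.inclusion Ioo_subset_Icc_self).prodMap IsEmbedding.id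
  refine h.measurableEmbedding ?_
  rw [range_toSlab]
  exact (measurable_subtype_coe.comp measurable_fst) measurableSet_Ioo

variable [CompactSpace (closure Ω)]

/-- The action of a pair of measures on a pair of continuous functions on the compact cylinder. -/
noncomputable def dualPair (μ : MeasPair Ω)
    (p : C(Slab Ω, ℝ) × C(Slab Ω, EuclideanSpace ℝ (Fin d))) : ℝ :=
  (∫ᵛ z, p.1 (toSlab z) ∂•μ.1) + ∫ᵛ z, p.2 (toSlab z) ∂[innerSL ℝ; μ.2]

theorem integrable_comp_toSlab {E : Type*} [NormedAddCommGroup E] [SecondCountableTopology E]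
    (g : C(Slab Ω, E)) (ρ : Measure (Cyl Ω)) [IsFiniteMeasure ρ] :
    Integrable (fun z => g (toSlab z)) ρ :=
  Integrable.of_bound (g.continuous.comp continuous_toSlab).aestronglyMeasurable ‖g‖
    (ae_of_all _ fun _ => g.norm_coe_le_norm _)

theorem dualPair_flowPair (ρ : Measure (Cyl Ω)) [IsFiniteMeasure ρ]
    {v : Cyl Ω → EuclideanSpace ℝ (Fin d)} (hv : Integrable v ρ)
    (p : C(Slab Ω, ℝ) × C(Slab Ω, EuclideanSpace ℝ (Fin d))) :
    dualPair (flowPair ρ v) p =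
      (∫ z, p.1 (toSlab z) ∂ρ) + ∫ z, inner ℝ (p.2 (toSlab z)) (v z) ∂ρ := by
  rw [dualPair]
  congr 1
  · exact integral_smul_toSignedMeasure ρ _
  · exact integral_withDensityᵥ_vectorMeasure hv (innerSL ℝ)
      (p.2.continuous.comp continuous_toSlab).stronglyMeasurable
      (fun z => p.2.norm_coe_le_norm (toSlab z))

theorem integrable_inner_toSlab (ρ : Measure (Cyl Ω))
    {v : Cyl Ω → EuclideanSpace ℝ (Fin d)} (hv : Integrable v ρ)
    (g : C(Slab Ω, EuclideanSpace ℝ (Fin d))) :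
    Integrable (fun z => inner ℝ (g (toSlab z)) (v z)) ρ :=
  integrable_bilin_of_bounded hv (innerSL ℝ)
    (g.continuous.comp continuous_toSlab).stronglyMeasurable
    (fun z => g.norm_coe_le_norm (toSlab z))

theorem dualPair_affine {μ ν : MeasPair Ω} [IsFiniteMeasure μ.2.variation]
    [IsFiniteMeasure ν.2.variation] (a b : ℝ) :
    dualPair (a • μ + b • ν) = a • dualPair μ + b • dualPair ν := by
  funext p
  have h1 : ∀ (μ : MeasPair Ω), VectorMeasure.Integrable μ.1 (fun z => p.1 (toSlab z)) :=
    fun μ => integrable_comp_toSlab p.1 _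
  have h2 : ∀ (μ : MeasPair Ω) [IsFiniteMeasure μ.2.variation],
      VectorMeasure.Integrable μ.2 (fun z => p.2 (toSlab z)) :=
    fun μ _ => integrable_comp_toSlab p.2 _
  simp only [dualPair, Prod.fst_add, Prod.snd_add, Prod.smul_fst, Prod.smul_snd, Pi.add_apply,
    Pi.smul_apply, smul_eq_mul]
  rw [VectorMeasure.integral_add_vectorMeasure ((h1 μ).smul_vectorMeasure _)
      ((h1 ν).smul_vectorMeasure _),
    VectorMeasure.integral_add_vectorMeasure ((h2 μ).smul_vectorMeasure _)
      ((h2 ν).smul_vectorMeasure _)]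
  simp only [VectorMeasure.integral_smul_vectorMeasure, smul_eq_mul]
  ring

theorem ext_of_integral_continuousMap {Y : Type*} [TopologicalSpace Y] [HasOuterApproxClosed Y]
    [MeasurableSpace Y] [BorelSpace Y] {μ ν : Measure Y}
    [IsFiniteMeasure μ] [IsFiniteMeasure ν] (h : ∀ g : C(Y, ℝ), ∫ y, g y ∂μ = ∫ y, g y ∂ν) :
    μ = ν :=
  ext_of_forall_integral_eq_of_IsFiniteMeasure fun g => h g.toContinuousMap

omit [CompactSpace (closure Ω)] in
theorem eq_of_integral_comp_toSlab {ρ ρ' : Measure (Cyl Ω)} [IsFiniteMeasure ρ]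
    [IsFiniteMeasure ρ'] (h : ∀ g : C(Slab Ω, ℝ), ∫ z, g (toSlab z) ∂ρ = ∫ z, g (toSlab z) ∂ρ') :
    ρ = ρ' := by
  rw [← measurableEmbedding_toSlab.comap_map ρ, ← measurableEmbedding_toSlab.comap_map ρ']
  congr 1
  refine ext_of_integral_continuousMap fun g => ?_
  rw [measurableEmbedding_toSlab.integral_map, measurableEmbedding_toSlab.integral_map, h]

theorem inner_toLp {Y F : Type*} [TopologicalSpace Y] [CompactSpace Y] [MeasurableSpace Y]
    [BorelSpace Y] [NormedAddCommGroup F] [InnerProductSpace ℝ F] [SecondCountableTopology F]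
    {m : Measure Y} [IsFiniteMeasure m] (g : C(Y, F)) (u : Lp F 2 m) :
    inner ℝ (ContinuousMap.toLp 2 m ℝ g) u = ∫ y, inner ℝ (g y) (u y) ∂m := by
  rw [L2.inner_def]
  refine integral_congr_ae ?_
  filter_upwards [ContinuousMap.coeFn_toLp (p := 2) (𝕜 := ℝ) m g] with y hy
  rw [hy]

/-- A square integrable field is determined by its action on continuous fields, which are dense. -/
theorem ae_eq_zero_of_integral_inner_toSlab {ρ : Measure (Cyl Ω)} [IsFiniteMeasure ρ]
    {u : Cyl Ω → EuclideanSpace ℝ (Fin d)} (hum : Measurable u) (hu : MemLp u 2 ρ)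
    (h : ∀ g : C(Slab Ω, EuclideanSpace ℝ (Fin d)), ∫ z, inner ℝ (g (toSlab z)) (u z) ∂ρ = 0) :
    u =ᵐ[ρ] 0 := by
  obtain ⟨u', hu'm, rfl⟩ := measurableEmbedding_toSlab.exists_measurable_extend hum
    fun _ => inferInstance
  have hu' : MemLp u' 2 (ρ.map toSlab) := measurableEmbedding_toSlab.memLp_map_measure_iff.2 hu
  have h0 : hu'.toLp = 0 := by
    refine (ContinuousMap.toLp_denseRange (EuclideanSpace ℝ (Fin d)) (ρ.map toSlab) ℝ
      (p := 2) (by simp)).eq_zero_of_inner_right ℝ fun g => ?_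
    rw [inner_toLp]
    refine Eq.trans ?_ ((measurableEmbedding_toSlab.integral_map
      (fun y => inner ℝ (g y) (u' y))).trans (h g))
    refine integral_congr_ae ?_
    filter_upwards [hu'.coeFn_toLp] with y hy
    rw [hy]
  have h1 : u' =ᵐ[ρ.map toSlab] 0 := by
    refine hu'.coeFn_toLp.symm.trans ?_
    rw [h0]
    exact Lp.coeFn_zero _ _ _
  exact measurableEmbedding_toSlab.ae_map_iff.1 h1

end Slab

/-! ### The unit ball as a compact set of functionals -/

section UnitBall

variable {d : ℕ} {Ω : Set (EuclideanSpace ℝ (Fin d))} {α β : ℝ}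

theorem J_flowPair_eq_ofReal (hα : 0 < α) (hβ : 0 < β) {ρ : Measure (Cyl Ω)} [IsFiniteMeasure ρ]
    {v : Cyl Ω → EuclideanSpace ℝ (Fin d)} (hvm : Measurable v) (hv : MemLp v 2 ρ)
    (hce : ContinuityEquation (flowPair ρ v)) :
    J α β (flowPair ρ v) =
      ENNReal.ofReal (β * ∫ z, ‖v z‖ ^ 2 / 2 ∂ρ + α * ρ.real univ) := by
  have h1 : Integrable (fun z => ‖v z‖ ^ 2 / 2) ρ := hv.integrable_norm_pow' .. |>.div_const 2
  have h2 : 0 ≤ ∫ z, ‖v z‖ ^ 2 / 2 ∂ρ := integral_nonneg fun z => by positivity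
  rw [J_flowPair α β ρ hvm (hv.integrable one_le_two) hce,
    ENNReal.ofReal_add (by positivity) (by positivity), ENNReal.ofReal_mul hβ.le,
    ENNReal.ofReal_mul hα.le, ofReal_integral_eq_lintegral_ofReal h1
      (ae_of_all _ fun z => by positivity), ofReal_measureReal]

theorem exists_flowPair_of_mem_unitBall (hα : 0 < α) (hβ : 0 < β) {μ : MeasPair Ω}
    (hμ : μ ∈ unitBall Ω α β) :
    ∃ (ρ : Measure (Cyl Ω)) (_ : IsFiniteMeasure ρ) (v : Cyl Ω → EuclideanSpace ℝ (Fin d)),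
      Measurable v ∧ MemLp v 2 ρ ∧ μ = flowPair ρ v ∧ ContinuityEquation (flowPair ρ v) ∧
        β * ∫ z, ‖v z‖ ^ 2 / 2 ∂ρ + α * ρ.real univ ≤ 1 := by
  have hJ : J α β μ ≤ 1 := hμ
  obtain ⟨hce, ρ, hρ, v, hvm, hv, rfl⟩ :=
    exists_flowPair_of_J_lt_top hβ (hJ.trans_lt ENNReal.one_lt_top)
  refine ⟨ρ, hρ, v, hvm, hv, rfl, hce, ?_⟩
  rwa [J_flowPair_eq_ofReal hα hβ hvm hv hce, ENNReal.ofReal_le_one] at hJ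

variable [CompactSpace (closure Ω)]

/-- The time derivative and the space gradient of a smooth function, on the compact cylinder. -/
noncomputable def slabDeriv {φ : ℝ × EuclideanSpace ℝ (Fin d) → ℝ} (h : ContDiff ℝ ∞ φ) :
    C(Slab Ω, ℝ) × C(Slab Ω, EuclideanSpace ℝ (Fin d)) :=
  (⟨fun y => timeDeriv φ ((y.1 : ℝ), (y.2 : EuclideanSpace ℝ (Fin d))),
      (continuous_timeDeriv h).comp (by fun_prop)⟩,
    ⟨fun y => spaceGrad φ ((y.1 : ℝ), (y.2 : EuclideanSpace ℝ (Fin d))),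
      (continuous_spaceGrad h).comp (by fun_prop)⟩)

/-- The conditions which characterize the actions on continuous functions of the elements of the
unit ball: linearity, the dual description of `J ≤ 1`, the continuity equation, and a time marginal
proportional to the Lebesgue measure. The last condition excludes mass at the times `0` and `1`. -/
structure IsFlowFunctional (α β : ℝ)
    (l : C(Slab Ω, ℝ) × C(Slab Ω, EuclideanSpace ℝ (Fin d)) → ℝ) : Prop where
  add : ∀ p q, l (p + q) = l p + l q
  smul : ∀ (c : ℝ) p, l (c • p) = c * l p
  le_one : ∀ p, (∀ y, p.1 y + ‖p.2 y‖ ^ 2 / (2 * β) ≤ α) → l p ≤ 1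
  deriv : ∀ (φ : ℝ × EuclideanSpace ℝ (Fin d) → ℝ) (h : IsTest φ), l (slabDeriv h.smooth) = 0
  time : ∀ η : C(I, ℝ), l (η.comp .fst, 0) = (∫ t, η t) * l (1, 0)

/-- The conditions are closed for pointwise convergence and bound each value, so that compactness
follows from Tychonoff's theorem. -/
theorem isCompact_isFlowFunctional (hα : 0 < α) (hβ : 0 < β) :
    IsCompact {l | IsFlowFunctional (Ω := Ω) α β l} := by
  -- a scaling factor which brings `p` into the region where functionals are at most `1`
  let s : C(Slab Ω, ℝ) × C(Slab Ω, EuclideanSpace ℝ (Fin d)) → ℝ := fun p =>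
    min 1 (α / (‖p.1‖ + ‖p.2‖ ^ 2 / (2 * β) + 1))
  have hs0 : ∀ p, 0 < s p := fun p => lt_min one_pos (by positivity)
  have hs : ∀ p y, (s p • p).1 y + ‖(s p • p).2 y‖ ^ 2 / (2 * β) ≤ α := by
    intro p y
    have h1 : s p ≤ 1 := min_le_left _ _
    have h2 : s p * (‖p.1‖ + ‖p.2‖ ^ 2 / (2 * β) + 1) ≤ α :=
      (le_div_iff₀ (by positivity)).1 (min_le_right _ _)
    have h3 : p.1 y ≤ ‖p.1‖ := (le_abs_self _).trans (p.1.norm_coe_le_norm y)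
    have h4 : ‖p.2 y‖ ≤ ‖p.2‖ := p.2.norm_coe_le_norm y
    have h5 : ‖p.2 y‖ ^ 2 / (2 * β) ≤ ‖p.2‖ ^ 2 / (2 * β) := by gcongr
    have h6 : 0 ≤ ‖p.2 y‖ ^ 2 / (2 * β) := by positivity
    simp only [Prod.smul_fst, Prod.smul_snd, ContinuousMap.smul_apply, norm_smul, smul_eq_mul,
      Real.norm_eq_abs, abs_of_pos (hs0 p), mul_pow, mul_div_assoc]
    have h7 : s p ^ 2 * (‖p.2 y‖ ^ 2 / (2 * β)) ≤ s p * (‖p.2 y‖ ^ 2 / (2 * β)) := by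
      gcongr
      exact pow_le_of_le_one (hs0 p).le h1 two_ne_zero
    have h8 : s p * (p.1 y + ‖p.2 y‖ ^ 2 / (2 * β)) ≤
        s p * (‖p.1‖ + ‖p.2‖ ^ 2 / (2 * β) + 1) :=
      mul_le_mul_of_nonneg_left (by linarith) (hs0 p).le
    linarith
  have hbox : IsCompact (univ.pi fun p => Icc (-(1 / s (-p))) (1 / s p)) :=
    isCompact_univ_pi fun p => isCompact_Icc
  refine hbox.of_isClosed_subset ?_ fun l hl p _ => ?_
  · have : {l | IsFlowFunctional (Ω := Ω) α β l} =
        {l | (∀ p q, l (p + q) = l p + l q) ∧ (∀ (c : ℝ) p, l (c • p) = c * l p) ∧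
          (∀ p, (∀ y, p.1 y + ‖p.2 y‖ ^ 2 / (2 * β) ≤ α) → l p ≤ 1) ∧
          (∀ (φ : ℝ × EuclideanSpace ℝ (Fin d) → ℝ) (h : IsTest φ), l (slabDeriv h.smooth) = 0) ∧
          ∀ η : C(I, ℝ), l (η.comp .fst, 0) = (∫ t, η t) * l (1, 0)} :=
      Set.ext fun l => ⟨fun h => ⟨h.1, h.2, h.3, h.4, h.5⟩,
        fun h => ⟨h.1, h.2.1, h.2.2.1, h.2.2.2.1, h.2.2.2.2⟩⟩
    rw [this]
    simp only [ofPred_and, ofPred_forall]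
    refine .inter ?_ (.inter ?_ (.inter ?_ (.inter ?_ ?_)))
    · exact isClosed_iInter fun p => isClosed_iInter fun q =>
        isClosed_eq (by fun_prop) (by fun_prop)
    · exact isClosed_iInter fun c => isClosed_iInter fun p =>
        isClosed_eq (by fun_prop) (by fun_prop)
    · exact isClosed_iInter fun p => isClosed_iInter fun _ =>
        isClosed_le (by fun_prop) (by fun_prop)
    · exact isClosed_iInter fun φ => isClosed_iInter fun _ =>
        isClosed_eq (by fun_prop) (by fun_prop)
    · exact isClosed_iInter fun η => isClosed_eq (by fun_prop) (by fun_prop)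
  · have key : ∀ q, l q ≤ 1 / s q := fun q => by
      have := hl.le_one _ (hs q)
      rw [hl.smul] at this
      rwa [le_div_iff₀ (hs0 q), mul_comm]
    refine ⟨?_, key p⟩
    have h1 := key (-p)
    have h2 : l (-p) = -l p := by
      rw [← neg_one_smul ℝ p, hl.smul, neg_one_mul]
    linarith

/-- The dual inequality is Young's inequality `h · v ≤ ‖h‖² / (2 β) + β ‖v‖² / 2`, integrated. -/
theorem isFlowFunctional_dualPair (hΩ : Bornology.IsBounded Ω) (hα : 0 < α) (hβ : 0 < β)
    {μ : MeasPair Ω} (hμ : μ ∈ unitBall Ω α β) : IsFlowFunctional α β (dualPair μ) := by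
  obtain ⟨ρ, hρ, v, hvm, hv, rfl, hce, hle⟩ := exists_flowPair_of_mem_unitBall hα hβ hμ
  have hvi := hv.integrable one_le_two
  have hi := fun g : C(Slab Ω, ℝ) => integrable_comp_toSlab g ρ
  have hi' := integrable_inner_toSlab ρ hvi
  refine ⟨fun p q => ?_, fun c p => ?_, fun p hp => ?_, fun φ h => ?_, fun η => ?_⟩
  · simp only [dualPair_flowPair ρ hvi, Prod.fst_add, Prod.snd_add, ContinuousMap.add_apply,
      inner_add_left]
    rw [integral_add (hi _) (hi _), integral_add (hi' _) (hi' _)]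
    ring
  · simp only [dualPair_flowPair ρ hvi, Prod.smul_fst, Prod.smul_snd, ContinuousMap.smul_apply,
      real_inner_smul_left, smul_eq_mul]
    rw [integral_const_mul, integral_const_mul]
    ring
  · rw [dualPair_flowPair ρ hvi, ← integral_add (hi _) (hi' _)]
    have h1 : Integrable (fun z => ‖v z‖ ^ 2 / 2) ρ := hv.integrable_norm_pow' .. |>.div_const 2
    calc _ ≤ ∫ z, (α + β * (‖v z‖ ^ 2 / 2)) ∂ρ := by
          refine integral_mono ((hi _).add (hi' _)) ((integrable_const _).add (h1.const_mul _))
            fun z => ?_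
          have h2 := hp (toSlab z)
          have h3 := real_inner_le_norm (p.2 (toSlab z)) (v z)
          have h4 : ‖p.2 (toSlab z)‖ * ‖v z‖ ≤
              ‖p.2 (toSlab z)‖ ^ 2 / (2 * β) + β * (‖v z‖ ^ 2 / 2) := by
            have h5 : ‖p.2 (toSlab z)‖ ^ 2 / (2 * β) + β * (‖v z‖ ^ 2 / 2) -
                ‖p.2 (toSlab z)‖ * ‖v z‖ = (‖p.2 (toSlab z)‖ - β * ‖v z‖) ^ 2 / (2 * β) := by
              field_simp
              ring
            have h6 : 0 ≤ (‖p.2 (toSlab z)‖ - β * ‖v z‖) ^ 2 / (2 * β) := by positivity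
            linarith
          simp only
          linarith
      _ ≤ 1 := by
          rw [integral_add (integrable_const _) (h1.const_mul _), integral_const,
            integral_const_mul, smul_eq_mul]
          linarith
  · rw [dualPair_flowPair ρ hvi, ← integral_add (hi _) (hi' _)]
    exact (continuityEquation_flowPair_iff ρ hvi).1 hce φ h
  · have hmap := hce.map_fst hΩ hvi
    have h1 := (integral_comp_fst hmap (g := fun t => η (Set.inclusion Ioo_subset_Icc_self t))
      (integrable_comp_inclusion (Integrable.of_bound η.continuous.aestronglyMeasurable ‖η‖
        (ae_of_all _ fun t => η.norm_coe_le_norm t)))).2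
    simp only [dualPair_flowPair ρ hvi, ContinuousMap.zero_apply, inner_zero_left, integral_zero,
      add_zero, ContinuousMap.one_apply, integral_const, smul_eq_mul, mul_one]
    rw [integral_Icc_eq_integral_Ioo, mul_comm]
    exact h1

theorem injOn_dualPair (hα : 0 < α) (hβ : 0 < β) :
    InjOn (dualPair : MeasPair Ω → _) (unitBall Ω α β) := by
  intro μ hμ μ' hμ' h
  obtain ⟨ρ, hρ, v, hvm, hv, rfl, -, -⟩ := exists_flowPair_of_mem_unitBall hα hβ hμ
  obtain ⟨ρ', hρ', v', hvm', hv', rfl, -, -⟩ := exists_flowPair_of_mem_unitBall hα hβ hμ'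
  have hvi := hv.integrable one_le_two
  have hvi' := hv'.integrable one_le_two
  have h1 : ρ = ρ' := eq_of_integral_comp_toSlab fun g => by
    simpa [dualPair_flowPair _ hvi, dualPair_flowPair _ hvi'] using congrFun h (g, 0)
  subst h1
  have h2 : v - v' =ᵐ[ρ] 0 := by
    refine ae_eq_zero_of_integral_inner_toSlab (hvm.sub hvm') (hv.sub hv') fun g => ?_
    have h3 := congrFun h (0, g)
    simp only [dualPair_flowPair _ hvi, dualPair_flowPair _ hvi', ContinuousMap.zero_apply,
      integral_zero, zero_add] at h3
    simp only [Pi.sub_apply, inner_sub_right]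
    rw [integral_sub (integrable_inner_toSlab ρ hvi g) (integrable_inner_toSlab ρ hvi' g), h3,
      sub_self]
  have h3 : v =ᵐ[ρ] v' := by
    filter_upwards [h2] with z hz
    exact sub_eq_zero.1 hz
  rw [flowPair, flowPair, WithDensityᵥEq.congr_ae h3]

end UnitBall

/-! ### Reconstructing a flow from its action on continuous functions -/

/-- Riesz representation for a functional on continuous vector fields with a quadratic upper bound.
Optimizing the bound over multiples of a field gives continuity for the `L²` norm. -/
theorem exists_field_of_quadratic_bound {Y F : Type*} [TopologicalSpace Y] [CompactSpace Y]
    [NormalSpace Y] [MeasurableSpace Y] [BorelSpace Y] [NormedAddCommGroup F]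
    [InnerProductSpace ℝ F] [CompleteSpace F] [SecondCountableTopology F] [MeasurableSpace F]
    [BorelSpace F] {m : Measure Y} [IsFiniteMeasure m] [m.WeaklyRegular] {b c : ℝ} (hb : 0 ≤ b)
    (hc : 0 ≤ c) (f : C(Y, F) →ₗ[ℝ] ℝ) (hf : ∀ g, f g ≤ b + c * ∫ y, ‖g y‖ ^ 2 ∂m) :
    ∃ u : Y → F, Measurable u ∧ MemLp u 2 m ∧ (∀ g : C(Y, F), f g = ∫ y, inner ℝ (g y) (u y) ∂m) ∧
      ∫ y, ‖u y‖ ^ 2 ∂m ≤ 4 * b * c := by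
  let e : C(Y, F) →L[ℝ] Lp F 2 m := ContinuousMap.toLp 2 m ℝ
  have he : ∀ g, ‖e g‖ ^ 2 = ∫ y, ‖g y‖ ^ 2 ∂m := by
    intro g
    rw [← real_inner_self_eq_norm_sq, inner_toLp]
    refine integral_congr_ae ?_
    filter_upwards [ContinuousMap.coeFn_toLp (p := 2) (𝕜 := ℝ) m g] with y hy
    rw [hy, real_inner_self_eq_norm_sq]
  have hdense : DenseRange e := ContinuousMap.toLp_denseRange F m ℝ (by simp)
  have hbound : ∀ g, ‖f g‖ ≤ √(4 * b * c) * ‖e g‖ := by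
    intro g
    have h1 : ∀ s : ℝ, 0 ≤ c * ‖e g‖ ^ 2 * (s * s) + (-f g) * s + b := by
      intro s
      have h2 := hf (s • g)
      rw [← he, map_smul, map_smul, norm_smul, mul_pow, Real.norm_eq_abs, sq_abs, smul_eq_mul] at h2
      linarith
    have h2 := discrim_le_zero h1
    rw [discrim] at h2
    rw [Real.norm_eq_abs, ← Real.sqrt_sq (norm_nonneg (e g)), ← Real.sqrt_mul (by positivity)]
    exact Real.abs_le_sqrt (by linarith)
  let E : StrongDual ℝ (Lp F 2 m) := f.extendOfNorm e.toLinearMap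
  have hE : ∀ g, E (e g) = f g := fun g =>
    LinearMap.extendOfNorm_eq (e := e.toLinearMap) hdense ⟨_, hbound⟩ g
  have hEn : ‖E‖ ≤ √(4 * b * c) := E.opNorm_le_bound (Real.sqrt_nonneg _)
    (LinearMap.norm_extendOfNorm_apply_le (e := e.toLinearMap) hdense _ hbound)
  let u : Lp F 2 m := (InnerProductSpace.toDual ℝ _).symm E
  refine ⟨u, (Lp.stronglyMeasurable u).measurable, Lp.memLp u, fun g => ?_, ?_⟩
  · rw [← hE g, ← inner_toLp, real_inner_comm]
    exact (InnerProductSpace.toDual_symm_apply (𝕜 := ℝ)).symm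
  · have h1 : ∫ y, ‖u y‖ ^ 2 ∂m = ‖u‖ ^ 2 := by
      rw [← real_inner_self_eq_norm_sq, L2.inner_def]
      simp only [real_inner_self_eq_norm_sq]
    rw [h1, LinearIsometryEquiv.norm_map]
    calc ‖E‖ ^ 2 ≤ √(4 * b * c) ^ 2 := by gcongr
      _ = 4 * b * c := Real.sq_sqrt (by positivity)

section UnitBall

variable {d : ℕ} {Ω : Set (EuclideanSpace ℝ (Fin d))} {α β : ℝ} [CompactSpace (closure Ω)]
  {l : C(Slab Ω, ℝ) × C(Slab Ω, EuclideanSpace ℝ (Fin d)) → ℝ}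

namespace IsFlowFunctional

omit [CompactSpace (closure Ω)] in
theorem apply_eq (h : IsFlowFunctional α β l)
    (p : C(Slab Ω, ℝ) × C(Slab Ω, EuclideanSpace ℝ (Fin d))) :
    l p = l (p.1, 0) + l (0, p.2) := by
  rw [← h.add]
  simp

omit [CompactSpace (closure Ω)] in
/-- Negative multiples of `(g, 0)` satisfy the constraint of the dual inequality however large they
are. -/
theorem nonneg (h : IsFlowFunctional α β l) (hα : 0 < α) {g : C(Slab Ω, ℝ)} (hg : ∀ y, 0 ≤ g y) :
    0 ≤ l (g, 0) := by
  by_contra! hneg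
  have h1 := h.le_one ((2 / l (g, 0)) • (g, 0)) fun y => by
    have : 2 / l (g, 0) * g y ≤ 0 :=
      mul_nonpos_of_nonpos_of_nonneg (div_nonpos_of_nonneg_of_nonpos zero_le_two hneg.le) (hg y)
    simpa using this.trans hα.le
  rw [h.smul, div_mul_cancel₀ _ hneg.ne] at h1
  norm_num at h1

theorem exists_measure (h : IsFlowFunctional α β l) (hα : 0 < α) :
    ∃ m : Measure (Slab Ω), IsFiniteMeasure m ∧ ∀ g : C(Slab Ω, ℝ), ∫ y, g y ∂m = l (g, 0) := by
  obtain ⟨m, hm, -, h1⟩ := exists_measure_of_nonneg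
    { toFun := fun g : C(Slab Ω, ℝ) => l (g, 0)
      map_add' := fun g g' => by rw [← h.add, Prod.mk_add_mk, add_zero]
      map_smul' := fun c g => by
          refine Eq.trans (congrArg l ?_) (h.smul c (g, 0))
          exact Prod.ext rfl (smul_zero (A := C(Slab Ω, EuclideanSpace ℝ (Fin d))) c).symm }
    fun g hg => h.nonneg hα hg
  exact ⟨m, hm, h1⟩

/-- The dual inequality at `(α - ‖g‖² / (2 β), g)` is a quadratic bound in `g`; its optimal form is
the energy bound. -/
theorem exists_field (h : IsFlowFunctional α β l) (hβ : 0 < β) {m : Measure (Slab Ω)}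
    [IsFiniteMeasure m] (hm : ∀ g : C(Slab Ω, ℝ), ∫ y, g y ∂m = l (g, 0)) :
    ∃ u : Slab Ω → EuclideanSpace ℝ (Fin d), Measurable u ∧ MemLp u 2 m ∧
      (∀ g : C(Slab Ω, EuclideanSpace ℝ (Fin d)), l (0, g) = ∫ y, inner ℝ (g y) (u y) ∂m) ∧
      β * ∫ y, ‖u y‖ ^ 2 / 2 ∂m + α * m.real univ ≤ 1 := by
  have h1 : ∀ g : C(Slab Ω, EuclideanSpace ℝ (Fin d)),
      l (0, g) ≤ (1 - α * m.real univ) + 1 / (2 * β) * ∫ y, ‖g y‖ ^ 2 ∂m := by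
    intro g
    -- the largest first component which the dual inequality admits
    let k : C(Slab Ω, ℝ) := ⟨fun y => α - ‖g y‖ ^ 2 / (2 * β), by fun_prop⟩
    have h2 := h.le_one (k, g) fun y => by simp [k]
    have hi : Integrable (fun y => ‖g y‖ ^ 2) m :=
      Integrable.of_bound (by fun_prop) (‖g‖ ^ 2) (ae_of_all _ fun y => by
        rw [norm_pow, norm_norm]
        gcongr
        exact g.norm_coe_le_norm y)
    have h3 : l (k, 0) = α * m.real univ - 1 / (2 * β) * ∫ y, ‖g y‖ ^ 2 ∂m := by
      rw [← hm]
      simp only [k, ContinuousMap.coe_mk]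
      rw [integral_sub (integrable_const _) (hi.div_const _), integral_const, integral_div,
        smul_eq_mul]
      ring
    rw [h.apply_eq, h3] at h2
    linarith
  have h0 : 0 ≤ 1 - α * m.real univ := by
    have := h1 0
    have h2 := h.add 0 0
    rw [add_zero] at h2
    have h3 : l (0, 0) = 0 := by
      change l 0 = 0
      linarith
    simp only [ContinuousMap.zero_apply, norm_zero, h3] at this
    simpa using this
  obtain ⟨u, hum, hu, hul, hle⟩ := exists_field_of_quadratic_bound (m := m) h0
    (by positivity : 0 ≤ 1 / (2 * β))
    { toFun := fun g : C(Slab Ω, EuclideanSpace ℝ (Fin d)) => l (0, g)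
      map_add' := fun g g' => by rw [← h.add, Prod.mk_add_mk, add_zero]
      map_smul' := fun c g => by
          refine Eq.trans (congrArg l ?_) (h.smul c (0, g))
          exact Prod.ext (smul_zero c).symm rfl } h1
  refine ⟨u, hum, hu, hul, ?_⟩
  rw [integral_div]
  have h2 : β * ∫ y, ‖u y‖ ^ 2 ∂m ≤ β * (4 * (1 - α * m.real univ) * (1 / (2 * β))) := by gcongr
  have h3 : β * (4 * (1 - α * m.real univ) * (1 / (2 * β))) = 2 * (1 - α * m.real univ) := by
    field_simp
    ring
  linarith

omit [CompactSpace (closure Ω)] in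
theorem measure_compl_range (h : IsFlowFunctional α β l) {m : Measure (Slab Ω)}
    [IsFiniteMeasure m] (hm : ∀ g : C(Slab Ω, ℝ), ∫ y, g y ∂m = l (g, 0)) :
    m (range toSlab)ᶜ = 0 := by
  have h1 : m.map Prod.fst = m univ • (volume : Measure I) := by
    have : IsFiniteMeasure (m univ • (volume : Measure I)) :=
      Measure.smul_finite _ (measure_ne_top m univ)
    refine ext_of_integral_continuousMap fun η => ?_
    rw [integral_map measurable_fst.aemeasurable η.continuous.aestronglyMeasurable,
      integral_smul_measure, smul_eq_mul]
    have h2 := hm (η.comp .fst)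
    have h3 := hm 1
    simp only [ContinuousMap.one_apply, integral_const, smul_eq_mul, mul_one] at h3
    rw [h.time, ← h3, mul_comm] at h2
    exact h2
  have h2 : (range (toSlab : Cyl Ω → Slab Ω))ᶜ = Prod.fst ⁻¹' ({0, 1} : Set I) := by
    rw [range_toSlab]
    ext y
    have h3 := y.1.2
    simp only [mem_compl_iff, mem_ofPred_eq, mem_preimage, mem_insert_iff, mem_singleton_iff,
      mem_Ioo, not_and_or, not_lt, Subtype.ext_iff]
    constructor
    · rintro (h4 | h4)
      · exact .inl (le_antisymm h4 h3.1)
      · exact .inr (le_antisymm h3.2 h4)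
    · rintro (h4 | h4)
      · exact .inl h4.le
      · exact .inr h4.ge
  rw [h2, ← Measure.map_apply measurable_fst ((Set.toFinite _).measurableSet), h1,
    Measure.smul_apply, (Set.toFinite ({0, 1} : Set I)).measure_zero, smul_zero]

/-- The representing measure and field live on the open cylinder, as the times `0` and `1` carry no
mass. -/
theorem exists_mem_unitBall (h : IsFlowFunctional α β l) (hα : 0 < α) (hβ : 0 < β) :
    ∃ μ ∈ unitBall Ω α β, dualPair μ = l := by
  obtain ⟨m, hm, hml⟩ := h.exists_measure hα
  obtain ⟨u, hum, hu, hul, hle⟩ := h.exists_field hβ hml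
  let ρ : Measure (Cyl Ω) := m.comap toSlab
  have hρ : ρ.map toSlab = m := by
    rw [measurableEmbedding_toSlab.map_comap]
    exact Measure.restrict_eq_self_of_ae_mem (h.measure_compl_range hml)
  have hρu : ρ univ = m univ := by
    rw [← hρ, Measure.map_apply measurableEmbedding_toSlab.measurable .univ, preimage_univ]
  have : IsFiniteMeasure ρ := ⟨hρu ▸ measure_lt_top m univ⟩
  have hint : ∀ g : Slab Ω → ℝ, ∫ z, g (toSlab z) ∂ρ = ∫ y, g y ∂m := fun g => by
    refine (measurableEmbedding_toSlab.integral_map g).symm.trans ?_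
    rw [hρ]
  have hvm : Measurable (u ∘ toSlab : Cyl Ω → _) := hum.comp measurableEmbedding_toSlab.measurable
  have hv : MemLp (u ∘ toSlab : Cyl Ω → _) 2 ρ :=
    measurableEmbedding_toSlab.memLp_map_measure_iff.1 (by rwa [hρ])
  have hvi := hv.integrable one_le_two
  have hdual : dualPair (flowPair ρ (u ∘ toSlab)) = l := by
    funext p
    rw [dualPair_flowPair ρ hvi, h.apply_eq, hul, ← hml, ← hint, ← hint]
    rfl
  have hce : ContinuityEquation (flowPair ρ (u ∘ toSlab)) := by
    refine (continuityEquation_flowPair_iff ρ hvi).2 fun φ hφ => ?_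
    have h1 := h.deriv φ hφ
    rw [← hdual, dualPair_flowPair ρ hvi,
      ← integral_add (integrable_comp_toSlab _ ρ) (integrable_inner_toSlab ρ hvi _)] at h1
    exact h1
  refine ⟨flowPair ρ (u ∘ toSlab), ?_, hdual⟩
  change J α β _ ≤ 1
  rw [J_flowPair_eq_ofReal hα hβ hvm hv hce, ENNReal.ofReal_le_one]
  have h1 := hint fun y => ‖u y‖ ^ 2 / 2
  have h2 : ρ.real univ = m.real univ := by simp [Measure.real, hρu]
  simp only [Function.comp_apply]
  rw [h1, h2]
  exact hle

end IsFlowFunctional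

theorem image_dualPair_unitBall (hΩ : Bornology.IsBounded Ω) (hα : 0 < α) (hβ : 0 < β) :
    dualPair '' unitBall Ω α β = {l | IsFlowFunctional α β l} := by
  refine Subset.antisymm ?_ fun l hl => IsFlowFunctional.exists_mem_unitBall hl hα hβ
  rintro _ ⟨μ, hμ, rfl⟩
  exact isFlowFunctional_dualPair hΩ hα hβ hμ

/-- The integral of an integrable family of continuous functions is maximized over the unit ball at
an extreme point. -/
theorem exists_extremePoint_unitBall (hΩ : Bornology.IsBounded Ω) (hα : 0 < α) (hβ : 0 < β)
    {w : I → C(closure Ω, ℝ)} (hw : Integrable w volume) :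
    ∃ μ ∈ (unitBall Ω α β).extremePoints ℝ, ∀ ν ∈ unitBall Ω α β,
      ∫ᵛ z, cylFun w z ∂•ν.1 ≤ ∫ᵛ z, cylFun w z ∂•μ.1 := by
  refine exists_extremePoint_forall_le (Φ := dualPair) (fun μ hμ ν hν a b => ?_)
    (injOn_dualPair hα hβ) ?_ ⟨0, ?_⟩ fun ε hε => ?_
  · obtain ⟨ρ, hρ, v, -, hv, rfl, -, -⟩ := exists_flowPair_of_mem_unitBall hα hβ hμ
    obtain ⟨ρ', hρ', v', -, hv', rfl, -, -⟩ := exists_flowPair_of_mem_unitBall hα hβ hν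
    have : IsFiniteMeasure (flowPair ρ v).2.variation :=
      isFiniteMeasure_variation_withDensityᵥ (hv.integrable one_le_two)
    have : IsFiniteMeasure (flowPair ρ' v').2.variation :=
      isFiniteMeasure_variation_withDensityᵥ (hv'.integrable one_le_two)
    exact dualPair_affine a b
  · rw [image_dualPair_unitBall hΩ hα hβ]
    exact isCompact_isFlowFunctional hα hβ
  · change J α β 0 ≤ 1
    rw [J_zero]
    exact zero_le_one
  · -- the mass of the elements of the unit ball is at most `1 / α`
    obtain ⟨k, hk, hki⟩ := hw.exists_boundedContinuous_integral_sub_le (mul_pos hε hα)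
    let g : C(Slab Ω, ℝ) := ContinuousMap.uncurry k.toContinuousMap
    refine ⟨ContinuousLinearMap.proj (g, 0), fun μ hμ => ?_⟩
    obtain ⟨ρ, hρ, v, -, hv, rfl, hce, hle⟩ := exists_flowPair_of_mem_unitBall hα hβ hμ
    have hvi := hv.integrable one_le_two
    have hmap := hce.map_fst hΩ hvi
    have h1 : ∫ᵛ z, cylFun w z ∂•(flowPair ρ v).1 = ∫ z, cylFun w z ∂ρ :=
      integral_smul_toSignedMeasure ρ _
    have h2 : dualPair (flowPair ρ v) (g, 0) = ∫ z, cylFun k z ∂ρ := by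
      rw [dualPair_flowPair ρ hvi]
      simp only [ContinuousMap.zero_apply, inner_zero_left, integral_zero, add_zero]
      rfl
    rw [ContinuousLinearMap.proj_apply, h1, h2,
      ← integral_sub (integrable_cylFun hmap hw) (integrable_cylFun hmap hki)]
    have h3 := abs_integral_cylFun_le hmap (hw.sub hki)
    have h4 : α * ρ.real univ ≤ 1 := by
      have : 0 ≤ ∫ z, ‖v z‖ ^ 2 / 2 ∂ρ := integral_nonneg fun z => by positivity
      nlinarith
    calc _ ≤ ρ.real univ * ∫ t, ‖w t - k t‖ := h3
      _ ≤ ρ.real univ * (ε * α) := by gcongr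
      _ = ε * (α * ρ.real univ) := by ring
      _ ≤ ε := mul_le_of_le_one_right hε.le h4

end UnitBall

/-! ### Scaling, and the linearized functional -/

/-- The function `φ` with real arguments, for `0 < M₀ < ∞`. -/
noncomputable def realPhi (m s : ℝ) : ℝ := if s ≤ m then s else (s ^ 2 + m ^ 2) / (2 * m)

theorem le_realPhi {m : ℝ} (hm : 0 < m) (s : ℝ) : s ≤ realPhi m s := by
  unfold realPhi
  split_ifs with h
  · exact le_rfl
  · rw [le_div_iff₀ (by positivity)]
    nlinarith [sq_nonneg (s - m)]

theorem phi_ofReal {m s : ℝ} (hm : 0 < m) (hs : 0 ≤ s) :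
    phi (ENNReal.ofReal m) (ENNReal.ofReal s) = ENNReal.ofReal (realPhi m s) := by
  unfold phi realPhi
  simp only [ENNReal.ofReal_le_ofReal_iff hm.le]
  split_ifs with h
  · rfl
  · rw [ENNReal.ofReal_div_of_pos (by positivity), ENNReal.ofReal_add (by positivity)
      (by positivity), ENNReal.ofReal_pow hs, ENNReal.ofReal_pow hm.le,
      ENNReal.ofReal_mul zero_le_two, ENNReal.ofReal_ofNat]

theorem phi_top {M0 : ℝ≥0∞} (hM0 : M0 ≠ ⊤) : phi M0 ⊤ = ⊤ := by
  rw [phi, if_neg (by simpa using hM0), ENNReal.top_pow two_ne_zero, top_add,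
    ENNReal.top_div_of_ne_top (ENNReal.mul_ne_top (by simp) hM0)]

theorem phi_zero_left {t : ℝ≥0∞} (ht : t ≠ 0) : phi 0 t = ⊤ := by
  rw [phi, if_neg (by simpa using ht), mul_zero, ENNReal.div_zero (by simp [ht])]

/-- If `p > 1`, the minimum of `s ↦ -s p + φ(s)` is attained at `m p`, and `φ(x) ≤ φ(m p)`. -/
theorem realPhi_le_of_one_lt {m p x s : ℝ} (hm : 0 < m) (hp : 1 < p) (hx : x ≤ m * p) :
    -(m * p * p) + realPhi m x ≤ -(s * p) + realPhi m s := by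
  have h1 : realPhi m x ≤ m * (p ^ 2 + 1) / 2 := by
    unfold realPhi
    split_ifs with h
    · nlinarith [sq_nonneg (p - 1)]
    · rw [div_le_iff₀ (by positivity)]
      have : x ^ 2 ≤ (m * p) ^ 2 := by
        gcongr
        linarith
      linarith
  have h2 : m * (1 - p ^ 2) / 2 ≤ -(s * p) + realPhi m s := by
    unfold realPhi
    split_ifs with h
    · nlinarith [mul_nonneg hm.le (sq_nonneg (p - 1)),
        mul_nonneg (sub_nonneg.2 h) (sub_nonneg.2 hp.le)]
    · have h3 : -(s * p) + (s ^ 2 + m ^ 2) / (2 * m) - m * (1 - p ^ 2) / 2 =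
          (s - m * p) ^ 2 / (2 * m) := by
        field_simp
        ring
      have h4 : 0 ≤ (s - m * p) ^ 2 / (2 * m) := by positivity
      linarith
  linarith

section Flow

variable {d : ℕ} {Ω : Set (EuclideanSpace ℝ (Fin d))} {α β : ℝ}

theorem smul_flowPair (c : ℝ≥0) (ρ : Measure (Cyl Ω)) [IsFiniteMeasure ρ]
    {v : Cyl Ω → EuclideanSpace ℝ (Fin d)} (hv : Integrable v ρ) :
    (c : ℝ) • flowPair ρ v = flowPair (c • ρ) v := by
  refine Prod.ext ?_ ?_
  · change (c : ℝ) • ρ.toSignedMeasure = (c • ρ).toSignedMeasure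
    rw [Measure.toSignedMeasure_smul]
    rfl
  · change (c : ℝ) • ρ.withDensityᵥ v = (c • ρ).withDensityᵥ v
    ext1 A hA
    rw [smul_apply, withDensityᵥ_apply hv hA,
      withDensityᵥ_apply hv.smul_measure_nnreal hA, Measure.restrict_smul,
      integral_smul_nnreal_measure]
    rfl

theorem ContinuityEquation.smul_flowPair {c : ℝ≥0} {ρ : Measure (Cyl Ω)} [IsFiniteMeasure ρ]
    {v : Cyl Ω → EuclideanSpace ℝ (Fin d)} (hv : Integrable v ρ)
    (h : ContinuityEquation (flowPair ρ v)) : ContinuityEquation (flowPair (c • ρ) v) := by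
  rw [continuityEquation_flowPair_iff _ hv.smul_measure_nnreal]
  intro φ hφ
  rw [integral_smul_nnreal_measure, (continuityEquation_flowPair_iff ρ hv).1 h φ hφ, smul_zero]

theorem J_smul (hα : 0 < α) (hβ : 0 < β) (c : ℝ≥0) {ν : MeasPair Ω} (h : J α β ν < ⊤) :
    J α β ((c : ℝ) • ν) = c * J α β ν := by
  obtain ⟨hce, ρ, hρ, v, hvm, hv, rfl⟩ := exists_flowPair_of_J_lt_top hβ h
  have hvi := hv.integrable one_le_two
  have h1 : (c • ρ).real univ = c * ρ.real univ := by
    simp [Measure.real]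
  have hvc : MemLp v 2 (c • ρ) := hv.smul_measure ENNReal.coe_ne_top
  rw [smul_flowPair c ρ hvi, J_flowPair_eq_ofReal hα hβ hvm hv hce,
    J_flowPair_eq_ofReal hα hβ hvm hvc (hce.smul_flowPair hvi), h1,
    integral_smul_nnreal_measure, ← ENNReal.ofReal_coe_nnreal,
    ← ENNReal.ofReal_mul c.coe_nonneg]
  congr 1
  rw [NNReal.smul_def, smul_eq_mul]
  ring

theorem pairing_ne_top (ρ : SignedMeasure (Cyl Ω)) (w : I → C(closure Ω, ℝ)) :
    pairing ρ w ≠ ⊤ := by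
  unfold pairing
  split_ifs
  · exact EReal.coe_ne_top _
  · exact bot_ne_top

variable {w : I → C(closure Ω, ℝ)}

theorem pairing_eq_of_J_lt_top [CompactSpace (closure Ω)] (hΩ : Bornology.IsBounded Ω)
    (hβ : 0 < β) (hw : Integrable w volume) {ν : MeasPair Ω} (h : J α β ν < ⊤) :
    pairing ν.1 w = ((∫ᵛ z, cylFun w z ∂•ν.1 : ℝ) : EReal) := by
  obtain ⟨hce, ρ, hρ, v, hvm, hv, rfl⟩ := exists_flowPair_of_J_lt_top hβ h
  rw [pairing_flowPair hΩ (hv.integrable one_le_two) hce hw]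
  congr 1
  exact (integral_smul_toSignedMeasure ρ _).symm

theorem linearized_eq_top_of_phi {M0 : ℝ≥0∞} {ν : MeasPair Ω} (h : phi M0 (J α β ν) = ⊤) :
    linearized α β M0 w ν = ⊤ := by
  rw [linearized, h, EReal.coe_ennreal_top]
  refine EReal.add_top_of_ne_bot ?_
  rw [Ne, EReal.neg_eq_bot_iff]
  exact pairing_ne_top _ _

theorem linearized_eq_coe [CompactSpace (closure Ω)] (hΩ : Bornology.IsBounded Ω)
    (hβ : 0 < β) (hw : Integrable w volume) {m : ℝ} (hm : 0 < m) {ν : MeasPair Ω}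
    (h : J α β ν < ⊤) : linearized α β (ENNReal.ofReal m) w ν =
      ((-(∫ᵛ z, cylFun w z ∂•ν.1) + realPhi m (J α β ν).toReal : ℝ) : EReal) := by
  have h1 : phi (ENNReal.ofReal m) (J α β ν) = ENNReal.ofReal (realPhi m (J α β ν).toReal) := by
    rw [← phi_ofReal hm ENNReal.toReal_nonneg, ENNReal.ofReal_toReal h.ne]
  rw [linearized, pairing_eq_of_J_lt_top hΩ hβ hw h, h1, EReal.coe_ennreal_ofReal,
    max_eq_left (ENNReal.toReal_nonneg.trans (le_realPhi hm _))]
  rfl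

theorem linearized_zero [CompactSpace (closure Ω)] (hΩ : Bornology.IsBounded Ω)
    (hw : Integrable w volume) (M0 : ℝ≥0∞) :
    linearized α β M0 w (0 : MeasPair Ω) = 0 := by
  rw [linearized, pairing_zero hΩ hw, J_zero, phi, if_pos zero_le]
  simp

/-- By homogeneity, the maximum `p` of the pairing over the unit ball bounds it by `p J`. -/
theorem integral_cylFun_le_mul (hα : 0 < α) (hβ : 0 < β) {p : ℝ}
    (hp : ∀ ν ∈ unitBall Ω α β, ∫ᵛ z, cylFun w z ∂•ν.1 ≤ p) {ν : MeasPair Ω} (h : J α β ν < ⊤) :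
    ∫ᵛ z, cylFun w z ∂•ν.1 ≤ (J α β ν).toReal * p := by
  have key : ∀ c : ℝ≥0, c * (J α β ν).toReal ≤ 1 → c * ∫ᵛ z, cylFun w z ∂•ν.1 ≤ p := by
    intro c hc
    have h1 := hp ((c : ℝ) • ν) (by
      change J α β ((c : ℝ) • ν) ≤ 1
      rw [J_smul hα hβ c h, ← ENNReal.ofReal_toReal h.ne, ← ENNReal.ofReal_coe_nnreal,
        ← ENNReal.ofReal_mul c.coe_nonneg, ENNReal.ofReal_le_one]
      exact hc)
    rwa [Prod.smul_fst, VectorMeasure.integral_smul_vectorMeasure, smul_eq_mul] at h1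
  rcases (ENNReal.toReal_nonneg (a := J α β ν)).eq_or_lt with h0 | h0
  · -- all multiples of `ν` are in the unit ball
    rw [← h0, zero_mul]
    by_contra! hpos
    have h1 := key (Real.toNNReal ((|p| + 1) / ∫ᵛ z, cylFun w z ∂•ν.1)) (by simp [← h0])
    rw [Real.coe_toNNReal _ (by positivity), div_mul_cancel₀ _ hpos.ne'] at h1
    linarith [le_abs_self p]
  · have h1 := key (Real.toNNReal (J α β ν).toReal⁻¹) (by
      rw [Real.coe_toNNReal _ (by positivity), inv_mul_cancel₀ h0.ne'])
    rwa [Real.coe_toNNReal _ (by positivity), inv_mul_le_iff₀ h0] at h1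

variable [CompactSpace (closure Ω)]

theorem isMinOn_neg_pairing_iff (hΩ : Bornology.IsBounded Ω) (hβ : 0 < β)
    (hw : Integrable w volume) {μ : MeasPair Ω} (hμ : μ ∈ unitBall Ω α β) :
    IsMinOn (fun ν : MeasPair Ω => -pairing ν.1 w) (unitBall Ω α β) μ ↔
      ∀ ν ∈ unitBall Ω α β, ∫ᵛ z, cylFun w z ∂•ν.1 ≤ ∫ᵛ z, cylFun w z ∂•μ.1 := by
  have h : ∀ ν ∈ unitBall Ω α β, pairing ν.1 w = ((∫ᵛ z, cylFun w z ∂•ν.1 : ℝ) : EReal) :=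
    fun ν hν => pairing_eq_of_J_lt_top hΩ hβ hw ((show J α β ν ≤ 1 from hν).trans_lt
      ENNReal.one_lt_top)
  rw [isMinOn_iff]
  refine forall₂_congr fun ν hν => ?_
  rw [EReal.neg_le_neg_iff, h ν hν, h μ hμ, EReal.coe_le_coe_iff]

/-- If `p ≤ 1`, or `M₀ = 0`, the linearized functional is nonnegative and `0` is a minimizer. If
`p > 1`, it is bounded below by the minimum of `s ↦ -s p + φ(s)`,
which the rescaled maximizer attains. -/
theorem linearized_rescale_le (hΩ : Bornology.IsBounded Ω) (hα : 0 < α) (hβ : 0 < β)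
    (hw : Integrable w volume) {M0 : ℝ≥0∞} (hM0 : M0 < ⊤) {μ : MeasPair Ω}
    (hμ : μ ∈ unitBall Ω α β)
    (hmin : IsMinOn (fun ν : MeasPair Ω => -pairing ν.1 w) (unitBall Ω α β) μ) (ν : MeasPair Ω) :
    linearized α β M0 w (rescale M0 (pairing μ.1 w) • μ) ≤ linearized α β M0 w ν := by
  have hJμ : J α β μ ≤ 1 := hμ
  have hJμ' : J α β μ < ⊤ := hJμ.trans_lt ENNReal.one_lt_top
  have hmax := (isMinOn_neg_pairing_iff hΩ hβ hw hμ).1 hmin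
  have h0μ : (0 : ℝ) • μ = 0 := zero_smul ℝ μ
  set p := ∫ᵛ z, cylFun w z ∂•μ.1 with hp
  rw [pairing_eq_of_J_lt_top hΩ hβ hw hJμ', ← hp]
  rcases eq_or_ne (J α β ν) ⊤ with hν | hν
  · rw [linearized_eq_top_of_phi (ν := ν) (by rw [hν, phi_top hM0.ne])]
    exact le_top
  have hνlt := lt_top_iff_ne_top.2 hν
  have hνp := integral_cylFun_le_mul hα hβ hmax hνlt
  have hs0 : 0 ≤ (J α β ν).toReal := ENNReal.toReal_nonneg
  rcases eq_or_ne M0 0 with rfl | hM0'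
  · have h1 : rescale 0 (p : EReal) = 0 := by simp [rescale]
    rw [h1, h0μ, linearized_zero hΩ hw]
    rcases eq_or_ne (J α β ν) 0 with h0 | h0
    · rw [h0, ENNReal.toReal_zero, zero_mul] at hνp
      rw [linearized, h0, pairing_eq_of_J_lt_top hΩ hβ hw hνlt, phi, if_pos le_rfl,
        EReal.coe_ennreal_zero, add_zero, ← EReal.coe_neg, EReal.coe_nonneg]
      linarith
    · rw [linearized_eq_top_of_phi (ν := ν) (phi_zero_left h0)]
      exact le_top
  have hm : 0 < M0.toReal := ENNReal.toReal_pos hM0' hM0.ne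
  have hνe := linearized_eq_coe hΩ hβ hw hm hνlt
  rw [ENNReal.ofReal_toReal hM0.ne] at hνe
  rw [hνe]
  rcases le_or_gt p 1 with hp1 | hp1
  · rw [rescale, if_pos (by exact_mod_cast hp1), h0μ, linearized_zero hΩ hw, EReal.coe_nonneg]
    nlinarith [le_realPhi hm (J α β ν).toReal]
  · have hr : rescale M0 (p : EReal) = M0.toReal * p := by
      rw [rescale, if_neg (by exact_mod_cast hp1.not_ge), EReal.toReal_coe]
    have hc : 0 ≤ M0.toReal * p := by positivity
    have hJ := J_smul hα hβ ⟨M0.toReal * p, hc⟩ hJμ'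
    have hJlt : J α β ((M0.toReal * p) • μ) < ⊤ :=
      hJ.trans_lt (ENNReal.mul_lt_top ENNReal.coe_lt_top hJμ')
    have he := linearized_eq_coe hΩ hβ hw hm hJlt
    rw [ENNReal.ofReal_toReal hM0.ne, Prod.smul_fst, VectorMeasure.integral_smul_vectorMeasure,
      smul_eq_mul, ← hp] at he
    rw [hr, he, EReal.coe_le_coe_iff]
    have hx : (J α β ((M0.toReal * p) • μ)).toReal ≤ M0.toReal * p := by
      have h1 : (J α β μ).toReal ≤ 1 := ENNReal.toReal_le_of_le_ofReal zero_le_one (by simpa)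
      have h2 := congrArg ENNReal.toReal hJ
      rw [ENNReal.toReal_mul] at h2
      refine h2.trans_le (mul_le_of_le_one_right hc h1)
    refine (realPhi_le_of_one_lt (s := (J α β ν).toReal) hm hp1 hx).trans ?_
    linarith

end Flow

end DynOT

theorem mainTheorem2
    {d : ℕ} (hd : 1 ≤ d)
    {Ω : Set (EuclideanSpace ℝ (Fin d))}
    (hΩ_open : IsOpen Ω) (hΩ_bdd : Bornology.IsBounded Ω) (hΩ_conn : IsConnected Ω)
    {D : Type*} [NormedAddCommGroup D] [NormedSpace ℝ D] [CompleteSpace D]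
    {H : I → Type*} [∀ t, NormedAddCommGroup (H t)] [∀ t, InnerProductSpace ℝ (H t)]
    [∀ t, CompleteSpace (H t)]
    (i : ∀ t, D →L[ℝ] H t) (hH : DynOT.AssumptionH i)
    (K : ∀ t, SignedMeasure (closure Ω) →ₗ[ℝ] H t) (hK : DynOT.AssumptionK i K)
    (f : ∀ t, H t) (hf : DynOT.MemL2H i f)
    (α β : ℝ) (hα : 0 < α) (hβ : 0 < β)
    (ρt : I → SignedMeasure (closure Ω)) (hρt : DynOT.NarrowlyContinuous ρt)
    (w : I → C(closure Ω, ℝ)) (hw : w = DynOT.dualVariable K f ρt)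
    (M0 : ℝ≥0∞) (hM0 : M0 = DynOT.Mzero α β K f) :
    (∃ μ ∈ (DynOT.unitBall Ω α β).extremePoints ℝ,
      IsMinOn (fun ν : DynOT.MeasPair Ω => -DynOT.pairing ν.1 w) (DynOT.unitBall Ω α β) μ) ∧
    ∀ μ ∈ (DynOT.unitBall Ω α β).extremePoints ℝ,
      IsMinOn (fun ν : DynOT.MeasPair Ω => -DynOT.pairing ν.1 w) (DynOT.unitBall Ω α β) μ →
      ∀ ν : DynOT.MeasPair Ω,
        DynOT.linearized α β M0 w (DynOT.rescale M0 (DynOT.pairing μ.1 w) • μ) ≤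
          DynOT.linearized α β M0 w ν := by
  have : CompactSpace (closure Ω) := isCompact_iff_compactSpace.1 hΩ_bdd.isCompact_closure
  have hwi : Integrable w volume := hw ▸ DynOT.integrable_dualVariable hH hK hf hρt
  have hM : M0 < ⊤ := hM0 ▸ DynOT.Mzero_lt_top hΩ_bdd α β hK hf
  refine ⟨?_, fun μ hμ hmin ν =>
    DynOT.linearized_rescale_le hΩ_bdd hα hβ hwi hM (extremePoints_subset hμ) hmin ν⟩
  obtain ⟨μ, hμ, hmax⟩ := DynOT.exists_extremePoint_unitBall hΩ_bdd hα hβ hwi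
  exact ⟨μ, hμ, (DynOT.isMinOn_neg_pairing_iff hΩ_bdd hβ hwi (extremePoints_subset hμ)).2 hmax⟩
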